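/- Let $d \ge 1$, $D = [0,1]^d \subset \mathbb{R}^d$, and let $k$ be either the squared exponential (SE) kernel $k(x,x') = \exp\big(-\tfrac{\|x-x'\|^2}{2l^2}\big)$ or the Matérn-$\nu$ kernel $k(x,x') = \tfrac{2^{1-\nu}}{\Gamma(\nu)}\big(\tfrac{\sqrt{2\nu}\,\|x-x'\|}{l}\big)^{\nu} K_\nu\big(\tfrac{\sqrt{2\nu}\,\|x-x'\|}{l}\big)$ (with value $1$ at $x = x'$), where $l, \nu > 0$ and $K_\nu$ is the modified Bessel function of the second kind. Let $B > 0$, and let $\mathcal{F}_k(B)$ be the set of functions $f$ on $D$ whose norm in the reproducing kernel Hilbert space of $k$ on $D$ is at most $B$. Noiseless setting with corrupted samples: there is an unknown $f \in \mathcal{F}_k(B)$. In each round $t = 1,\dots,T$, a deterministic algorithm chooses $x_t \in D$ as a function of $(x_i,\tilde y_i)_{i<t}$; an adversary, knowing $f$, $(x_i, f(x_i))_{i<t}$ and $x_t$, chooses a function $c_t : D \to [-B_0,B_0]$, where $B_0 > 0$ is constant; the algorithm then observes $\tilde y_t = f(x_t) + c_t(x_t)$. The adversary must satisfy $\sum_{t=1}^T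 \sup_{x \in D} |c_t(x)| \le C$. The cumulative regret is $R_T = \sum_{t=1}^T \big(f(x^*) - f(x_t)\big)$, where $x^*$ is a maximizer of $f$ on $D$. **Theorem.** Fix $d, l, \nu, B, B_0$ and constants $c_1 > 0$, $\eta > 0$. There exist $c > 0$ and $T_0$, depending only on these constants (and on the kernel), such that for all $T \ge T_0$ and all $C$ with $c_1 \le C \le T^{1-\eta}$ (that is, $\Theta(1) \le C \le T^{1-\Omega(1)}$), there is an adversary strategy respecting the above constraints such that every deterministic algorithm (including those knowing $C$ and $T$) incurs, for some $f \in \mathcal{F}_k(B)$ and with certainty: * under the SE kernel, $R_T \ge c\, C (\log T)^{d/2}$, i.e. $R_T = \Omega\big(C (\log T)^{d/2}\big)$; * under the Matérn-$\nu$ kernel, $R_T \ge c\, C^{\frac{\nu}{d+\nu}} T^{\frac{d}{d+\nu}}$, i.e. $R_T = \Omega\big(C^{\frac{\nu}{d+\nu}} T^{\frac{d}{d+\nu}}\big)$. -/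

import Mathlib

noncomputable section

namespace CorruptedBandit

/-- The domain `D = [0,1]^d`, a subset of Euclidean space `ℝ^d`. -/
abbrev Dom (d : ℕ) : Type := {x : EuclideanSpace ℝ (Fin d) // ∀ i, x i ∈ Set.Icc (0 : ℝ) 1}

/-! ### Kernels -/

/-- The squared exponential kernel with length-scale `l`. -/
def kSE {d : ℕ} (l : ℝ) (x x' : Dom d) : ℝ :=
  Real.exp (-(dist x x' ^ 2) / (2 * l ^ 2))

/-- The modified Bessel function of the second kind
`K_ν(z) = ∫_0^∞ exp(-z cosh t) cosh(ν t) dt`, for real `z > 0`. -/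
def besselK (ν z : ℝ) : ℝ :=
  ∫ t in Set.Ioi (0 : ℝ), Real.exp (-z * Real.cosh t) * Real.cosh (ν * t)

/-- The Matérn kernel with length-scale `l` and smoothness `ν`. At distance zero, where the
formula is an indeterminate `0 · ∞`, its value is the limit `1`. -/
def kMatern {d : ℕ} (l ν : ℝ) (x x' : Dom d) : ℝ :=
  if dist x x' = 0 then 1
  else (2 : ℝ) ^ (1 - ν) / Real.Gamma ν * (Real.sqrt (2 * ν) * dist x x' / l) ^ ν
    * besselK ν (Real.sqrt (2 * ν) * dist x x' / l)

/-- The ball of radius `B` in the reproducing kernel Hilbert space of the kernel `k`, as a set of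
functions on `X`: the functions `f` that belong to the RKHS `H` with reproducing kernel `k` and
have `‖f‖_H ≤ B`. Two RKHSs with the same kernel are the same space of functions with the same
norm, so it does not matter which copy `H` is used. -/
def rkhsBall {X : Type} (k : X → X → ℝ) (B : ℝ) : Set (X → ℝ) :=
  {f | ∃ (H : Type) (_ : NormedAddCommGroup H) (_ : InnerProductSpace ℝ H)
      (_ : CompleteSpace H) (_ : RKHS ℝ H X ℝ),
      (∀ x y : X, RKHS.kernel H x y 1 = k x y) ∧ ∃ g : H, (∀ x : X, g x = f x) ∧ ‖g‖ ≤ B}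

/-! ### The game with corrupted samples (noiseless) -/

/-- A deterministic algorithm: the list of previous observations `(x_i, ỹ_i)`, oldest first,
determines the next point. -/
abbrev Algorithm (d : ℕ) : Type := List (Dom d × ℝ) → Dom d

/-- An adversary: given the true function `f`, the list of previous uncorrupted samples
`(x_i, y_i)`, oldest first, and the player's current choice `x_t` (for a deterministic algorithm,
knowing the distribution of `x_t` is the same as knowing `x_t`), it selects the corruption
function `c_t` on the domain. -/
abbrev Adversary (d : ℕ) : Type :=
  (Dom d → ℝ) → List (Dom d × ℝ) → Dom d → (Dom d → ℝ)

variable {d : ℕ}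

/-- The first `t` rounds of the game on `f`, as the list of pairs `(x_i, c_i)`, oldest first. The
uncorrupted sample of such a round is `y_i = f x_i`, and the player observes
`ỹ_i = f x_i + c_i x_i`. -/
def rounds (alg : Algorithm d) (adv : Adversary d) (f : Dom d → ℝ) :
    ℕ → List (Dom d × (Dom d → ℝ))
  | 0 => []
  | t + 1 =>
    let past := rounds alg adv f t
    let x := alg (past.map fun r => (r.1, f r.1 + r.2 r.1))
    let c := adv f (past.map fun r => (r.1, f r.1)) x
    past ++ [(x, c)]

/-- The point played in the round with index `t` (indices start at `0`). -/
def point (alg : Algorithm d) (adv : Adversary d) (f : Dom d → ℝ) (t : ℕ) : Dom d :=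
  alg ((rounds alg adv f t).map fun r => (r.1, f r.1 + r.2 r.1))

/-- The corruption function chosen in the round with index `t`. -/
def corruption (alg : Algorithm d) (adv : Adversary d) (f : Dom d → ℝ) (t : ℕ) : Dom d → ℝ :=
  adv f ((rounds alg adv f t).map fun r => (r.1, f r.1)) (point alg adv f t)

/-- The adversary respects the rules over `T` rounds, whatever the algorithm and the function:
each corruption function takes values in `[-B₀, B₀]`, and the total corruption
`∑_t sup_x |c_t(x)|` is at most `C`. -/
def Adversary.Admissible (adv : Adversary d) (B₀ C : ℝ) (T : ℕ) : Prop :=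
  ∀ (alg : Algorithm d) (f : Dom d → ℝ),
    (∀ t < T, ∀ x, |corruption alg adv f t x| ≤ B₀) ∧
      ∑ t ∈ Finset.range T, ⨆ x, |corruption alg adv f t x| ≤ C

/-- The cumulative regret `∑_t (f(x*) - f(x_t))` over `T` rounds, with respect to the reference
point `xstar` (which is to be a maximizer of `f`). -/
def cumRegret (alg : Algorithm d) (adv : Adversary d) (f : Dom d → ℝ) (xstar : Dom d)
    (T : ℕ) : ℝ :=
  ∑ t ∈ Finset.range T, (f xstar - f (point alg adv f t))

end CorruptedBandit

end

open CorruptedBandit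

/-!
The lower bound comes from needles in a haystack. Suppose that there are `M` functions
`b i : D → [0, 1]` that reach the value `1`, have RKHS norm at most `N`, and satisfy
`∑ i, b i ≤ K` pointwise. Scale them by `ε` with `ε N ≤ B` and `ε ≤ B₀`. The adversary
`zeroingAdversary` cancels every sample by the constant function `-f(x_t)`, as long as its budget
lasts; its rule uses neither the algorithm nor the time. Let `x_t` be the points that the algorithm
plays when it sees only zeros. Since `∑ i, ∑ t, ε * b i (x_t) ≤ ε K T`, some `i` has
`∑ t, ε * b i (x_t) ≤ ε K T / M`. If this is at most `C`, the budget suffices for `f = ε * b i`, the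
algorithm does play these points, and its regret is `ε T - ∑ t, f(x_t) ≥ ε T - C`
(`regret_of_needles`). With `ε = C M / (K T)` this is `C (M / K - 1)`, so the aim is to have as many
needles as the constraint on the norm allows. They are placed at a grid of `M = n ^ d` points.

Norms are bounded by a feature map: if `k(x, y) = ∫ φ_x φ_y dμ`, then `x ↦ ∫ w φ_x dμ` lies in the
RKHS and has norm at most `‖w‖` in `L²(μ)` (`mem_rkhsBall_of_memLp`).

For the squared exponential kernel the features are Gaussians in `L²(ℝ^d)`. A Gaussian times
`cos ⟨β, x - g⟩` then has norm at most `exp (l² ‖β‖² / 2)`, so that a Gaussian times a trigonometric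
polynomial of degree less than `n` in each coordinate costs a norm of `exp (O(n²))`. The needles
use the kernel `|n⁻ᵈ ∑_J exp (2πi⟨J, x - m/n⟩)|²`, whose translates to the grid add up to exactly `1`
by orthogonality of characters (`sum_seNeedle_le_one`). Thus `n` can be of order `√(log T)`.

The Matérn kernel is a mixture of Gaussian kernels `exp (-ν r² / (2 l² s))`, with `s` gamma
distributed with shape `ν` (`kMatern_eq_integral`). The part of the mixture with
`s ∈ [s₀, 2 s₀]`, normalized to height `1`, is a needle of width of order `√s₀`, and its squared norm
is the inverse of the probability of `[s₀, 2 s₀]`, hence `O(s₀ ^ (-ν))`. With `s₀ = n⁻²` the norm is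
`O(n ^ ν)`, so that `n` can be of order `(T / C) ^ (1 / (d + ν))`.
-/

open CorruptedBandit

noncomputable section

namespace CorruptedBandit

open MeasureTheory Filter Topology
open scoped InnerProductSpace

variable {d : ℕ}

/-! ### Functions in the RKHS from a feature map -/

section RKHS

variable {X : Type} {k : X → X → ℝ}

lemma rkhsBall_smul {f : X → ℝ} {N B ε : ℝ} (hε : 0 ≤ ε) (hf : f ∈ rkhsBall k N)
    (hB : ε * N ≤ B) : (fun x => ε * f x) ∈ rkhsBall k B := by
  obtain ⟨H, i₁, i₂, i₃, i₄, hk, g, hg, hN⟩ := hf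
  refine ⟨H, i₁, i₂, i₃, i₄, hk, ε • g, fun x => ?_, ?_⟩
  · rw [RKHS.coe_smul, Pi.smul_apply, hg, smul_eq_mul]
  · rw [norm_smul, Real.norm_of_nonneg hε]
    exact (mul_le_mul_of_nonneg_left hN hε).trans hB

/-- If `k` has a feature map `φ` into a Hilbert space `W`, then every `w : W` gives the function
`x ↦ ⟪w, φ x⟫` in the RKHS of `k`, of norm at most `‖w‖`: the RKHS is the closed span of the
features, and the function is represented by the orthogonal projection of `w` to it. -/
lemma mem_rkhsBall_of_feature {W : Type} [NormedAddCommGroup W] [InnerProductSpace ℝ W]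
    [CompleteSpace W] (φ : X → W) (hk : ∀ x y, ⟪φ x, φ y⟫_ℝ = k x y) (w : W) {N : ℝ}
    (hw : ‖w‖ ≤ N) : (fun x => ⟪w, φ x⟫_ℝ) ∈ rkhsBall k N := by
  set V : Submodule ℝ W := (Submodule.span ℝ (Set.range φ)).topologicalClosure with hV
  have hφ : ∀ x, φ x ∈ V := fun x =>
    Submodule.le_topologicalClosure _ (Submodule.subset_span ⟨x, rfl⟩)
  have : CompleteSpace V :=
    (Submodule.isClosed_topologicalClosure _).completeSpace_coe
  let L : V →L[ℝ] X → ℝ :=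
    ContinuousLinearMap.pi fun x => (innerSL ℝ (φ x)).comp V.subtypeL
  have hL : ∀ v x, L v x = ⟪φ x, (v : W)⟫_ℝ := fun v x => rfl
  have hinj : Function.Injective (L : V → X → ℝ) := by
    rw [injective_iff_map_eq_zero]
    intro v hv
    have h1 : (v : W) ∈ (Submodule.span ℝ (Set.range φ))ᗮ := by
      rw [Submodule.mem_orthogonal]
      intro u hu
      induction hu using Submodule.span_induction with
      | mem u hu =>
        obtain ⟨x, rfl⟩ := hu
        rw [← hL, hv]; rfl
      | zero => simp
      | add u₁ u₂ _ _ h₁ h₂ => rw [inner_add_left, h₁, h₂, add_zero]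
      | smul a u _ h => rw [inner_smul_left, h, mul_zero]
    rw [← Submodule.orthogonal_closure] at h1
    have h2 : ⟪(v : W), (v : W)⟫_ℝ = 0 := (Submodule.mem_orthogonal _ _).1 h1 _ v.2
    exact Subtype.ext (inner_self_eq_zero.1 h2)
  let : RKHS ℝ V X ℝ := ⟨L, hinj⟩
  have hcoe : ∀ (v : V) x, v x = ⟪φ x, (v : W)⟫_ℝ := fun v x => rfl
  have hker : ∀ y, RKHS.kerFun V y (1 : ℝ) = (⟨φ y, hφ y⟩ : V) := by
    intro y
    refine ext_inner_right ℝ fun v => ?_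
    rw [RKHS.kerFun_inner, hcoe]
    simp
  refine ⟨V, _, _, inferInstance, inferInstance, fun x y => ?_, V.orthogonalProjectionOnto w,
    fun x => ?_, ?_⟩
  · rw [← RKHS.kerFun_apply, hker, hcoe]
    exact hk x y
  · rw [hcoe, real_inner_comm]
    exact Submodule.inner_orthogonalProjectionOnto_eq_of_mem_right (⟨φ x, hφ x⟩ : V) w
  · exact (V.norm_orthogonalProjectionOnto_apply_le w).trans hw

/-- The feature map criterion for features in an `L²` space. -/
lemma mem_rkhsBall_of_memLp {Ω : Type} [MeasurableSpace Ω] (μ : Measure Ω) (φ : X → Ω → ℝ)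
    (hφ : ∀ x, MemLp (φ x) 2 μ) (hk : ∀ x y, ∫ ω, φ x ω * φ y ω ∂μ = k x y)
    {w : Ω → ℝ} (hw : MemLp w 2 μ) {N : ℝ} (hN : 0 ≤ N) (hwN : ∫ ω, w ω ^ 2 ∂μ ≤ N ^ 2) :
    (fun x => ∫ ω, w ω * φ x ω ∂μ) ∈ rkhsBall k N := by
  have key : ∀ {f g : Ω → ℝ} (hf : MemLp f 2 μ) (hg : MemLp g 2 μ),
      ⟪hf.toLp f, hg.toLp g⟫_ℝ = ∫ ω, f ω * g ω ∂μ := by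
    intro f g hf hg
    rw [L2.inner_def]
    refine integral_congr_ae ?_
    filter_upwards [hf.coeFn_toLp, hg.coeFn_toLp] with ω h₁ h₂
    rw [h₁, h₂, RCLike.inner_apply, conj_trivial, mul_comm]
  have hnorm : ‖hw.toLp w‖ ≤ N := by
    refine le_of_sq_le_sq ?_ hN
    rw [← real_inner_self_eq_norm_sq, key]
    simpa only [sq] using hwN
  have := mem_rkhsBall_of_feature (k := k) (fun x => (hφ x).toLp (φ x))
    (fun x y => by rw [key, hk]) (hw.toLp w) hnorm
  simpa only [key] using this

end RKHS

/-! ### The zeroing adversary and the needle argument -/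

/-- The adversary that makes every sample equal to zero, by a corruption that is constant on the
domain, as long as this keeps the total corruption within `C` and the single one within `B₀`. -/
def zeroingAdversary (B₀ C : ℝ) : Adversary d := fun f past x _ =>
  if |f x| ≤ B₀ ∧ (past.map fun p => |p.2|).sum + |f x| ≤ C then -f x else 0

lemma rounds_succ (alg : Algorithm d) (adv : Adversary d) (f : Dom d → ℝ) (t : ℕ) :
    rounds alg adv f (t + 1) =
      rounds alg adv f t ++ [(point alg adv f t, corruption alg adv f t)] := rfl

lemma sum_abs_rounds (alg : Algorithm d) (adv : Adversary d) (f : Dom d → ℝ) (t : ℕ) :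
    (((rounds alg adv f t).map fun r => (r.1, f r.1)).map fun p => |p.2|).sum =
      ∑ i ∈ Finset.range t, |f (point alg adv f i)| := by
  induction t with
  | zero => simp [rounds]
  | succ t ih => rw [rounds_succ, Finset.sum_range_succ, ← ih]; simp

lemma corruption_zeroing (alg : Algorithm d) (f : Dom d → ℝ) (B₀ C : ℝ) (t : ℕ) (x : Dom d) :
    corruption alg (zeroingAdversary B₀ C) f t x =
      if |f (point alg (zeroingAdversary B₀ C) f t)| ≤ B₀ ∧
        ∑ i ∈ Finset.range (t + 1), |f (point alg (zeroingAdversary B₀ C) f i)| ≤ C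
      then -f (point alg (zeroingAdversary B₀ C) f t) else 0 := by
  rw [Finset.sum_range_succ, ← sum_abs_rounds]
  rfl

lemma zeroingAdversary_admissible {B₀ C : ℝ} (hB₀ : 0 ≤ B₀) (hC : 0 ≤ C) (T : ℕ) :
    (zeroingAdversary B₀ C : Adversary d).Admissible B₀ C T := by
  intro alg f
  set adv : Adversary d := zeroingAdversary B₀ C
  constructor
  · intro t _ x
    rw [corruption_zeroing]
    split_ifs with h
    · simpa using h.1
    · simpa using hB₀
  · -- a corruption in use at time `t` witnesses that the whole sum up to time `t` is within `C`
    have hsup : ∀ t, ⨆ x, |corruption alg adv f t x| =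
        if |f (point alg adv f t)| ≤ B₀ ∧
          ∑ i ∈ Finset.range (t + 1), |f (point alg adv f i)| ≤ C
        then |f (point alg adv f t)| else 0 := by
      intro t
      have : Nonempty (Dom d) := ⟨point alg adv f t⟩
      simp only [adv, corruption_zeroing]
      split_ifs <;> simp
    induction T with
    | zero => simpa using hC
    | succ T ih =>
      rw [Finset.sum_range_succ, hsup T]
      split_ifs with h
      · refine le_trans ?_ h.2
        rw [Finset.sum_range_succ]
        gcongr with t
        rw [hsup t]
        split_ifs
        · exact le_rfl
        · positivity
      · simpa using ih

/-- The observations of the first `t` rounds if the algorithm sees only zeros; the next point is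
then `alg (zeroPlay alg t)`. -/
def zeroPlay (alg : Algorithm d) : ℕ → List (Dom d × ℝ)
  | 0 => []
  | t + 1 => zeroPlay alg t ++ [(alg (zeroPlay alg t), 0)]

/-- If the zeroing adversary can afford to cancel `f` along the play on zeros, the algorithm sees
only zeros. -/
lemma observations_eq_zeroPlay (alg : Algorithm d) (f : Dom d → ℝ) {B₀ C : ℝ}
    (hf : ∀ x, |f x| ≤ B₀) (T : ℕ)
    (hC : ∑ t ∈ Finset.range T, |f (alg (zeroPlay alg t))| ≤ C) (t : ℕ) (ht : t ≤ T) :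
    (rounds alg (zeroingAdversary B₀ C) f t).map (fun r => (r.1, f r.1 + r.2 r.1)) =
      zeroPlay alg t := by
  induction t using Nat.strong_induction_on with
  | _ t ih =>
    cases t with
    | zero => rfl
    | succ t =>
      have hp : ∀ i ≤ t, point alg (zeroingAdversary B₀ C) f i = alg (zeroPlay alg i) := by
        intro i hi
        rw [point, ih i (by omega) (by omega)]
      have hc : corruption alg (zeroingAdversary B₀ C) f t (alg (zeroPlay alg t)) =
          -f (alg (zeroPlay alg t)) := by
        rw [corruption_zeroing, hp t le_rfl, if_pos]
        refine ⟨hf _, le_trans ?_ hC⟩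
        rw [Finset.sum_congr rfl fun i hi => by rw [hp i (by simp at hi; omega)]]
        exact Finset.sum_le_sum_of_subset_of_nonneg
          (Finset.range_mono ht) fun _ _ _ => abs_nonneg _
      rw [rounds_succ, List.map_append, ih t (by omega) (by omega)]
      simp [zeroPlay, hp t le_rfl, hc]

/-- A family of needles `b i`, of height `1`, that overlap at most `K`-fold forces regret: at the
height `ε`, the samples of at least one of them can be hidden over all `T` rounds at a cost of at
most `ε K T / M`, where `M` is their number. -/
lemma regret_of_needles {k : Dom d → Dom d → ℝ} {B B₀ C ε K N : ℝ} {T : ℕ}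
    {ι : Type*} [Fintype ι] [Nonempty ι] (b : ι → Dom d → ℝ) (g : ι → Dom d)
    (hb0 : ∀ i x, 0 ≤ b i x) (hb1 : ∀ i x, b i x ≤ 1) (hbg : ∀ i, b i (g i) = 1)
    (hsum : ∀ x, ∑ i, b i x ≤ K) (hmem : ∀ i, b i ∈ rkhsBall k N)
    (hε : 0 ≤ ε) (hεB : ε * N ≤ B) (hεB₀ : ε ≤ B₀)
    (hC : ε * K * T ≤ Fintype.card ι * C) (hC0 : 0 ≤ C) :
    ∃ adv : Adversary d, adv.Admissible B₀ C T ∧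
      ∀ alg : Algorithm d, ∃ f ∈ rkhsBall k B,
        ∃ xstar : Dom d, (∀ x, f x ≤ f xstar) ∧ ε * T - C ≤ cumRegret alg adv f xstar T := by
  refine ⟨zeroingAdversary B₀ C, zeroingAdversary_admissible (hε.trans hεB₀) hC0 T,
    fun alg => ?_⟩
  obtain ⟨i, -, hi⟩ : ∃ i ∈ (Finset.univ : Finset ι),
      ∑ t ∈ Finset.range T, ε * b i (alg (zeroPlay alg t)) ≤ C := by
    refine Finset.exists_le_of_sum_le Finset.univ_nonempty ?_
    rw [Finset.sum_comm, Finset.sum_const, Finset.card_univ, nsmul_eq_mul]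
    refine le_trans ?_ hC
    calc ∑ t ∈ Finset.range T, ∑ i, ε * b i (alg (zeroPlay alg t))
        ≤ ∑ t ∈ Finset.range T, ε * K := by
          refine Finset.sum_le_sum fun t _ => ?_
          rw [← Finset.mul_sum]
          exact mul_le_mul_of_nonneg_left (hsum _) hε
      _ = ε * K * T := by rw [Finset.sum_const, Finset.card_range, nsmul_eq_mul]; ring
  have habs : ∀ x, |ε * b i x| = ε * b i x := fun x => abs_of_nonneg (mul_nonneg hε (hb0 i x))
  have hle : ∀ x, ε * b i x ≤ ε := fun x => mul_le_of_le_one_right hε (hb1 i x)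
  refine ⟨fun x => ε * b i x, rkhsBall_smul hε (hmem i) hεB, g i, fun x => ?_, ?_⟩
  · simpa [hbg i] using hle x
  · have hobs := observations_eq_zeroPlay alg (fun x => ε * b i x) (B₀ := B₀) (C := C)
      (fun x => by rw [habs]; exact (hle x).trans hεB₀) T (by simpa only [habs] using hi)
    have hp : ∀ t ∈ Finset.range T, point alg (zeroingAdversary B₀ C) (fun x => ε * b i x) t =
        alg (zeroPlay alg t) := by
      intro t ht
      rw [point, hobs t (Finset.mem_range.1 ht).le]
    rw [cumRegret, Finset.sum_congr rfl fun t ht => congrArg (fun y => _ - ε * b i y) (hp t ht),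
      Finset.sum_sub_distrib]
    simp only [hbg, Finset.sum_const, Finset.card_range, nsmul_eq_mul]
    linarith

/-! ### Gaussian integrals -/

section Gaussian

variable {V : Type*} [NormedAddCommGroup V] [InnerProductSpace ℝ V] [FiniteDimensional ℝ V]
  [MeasurableSpace V] [BorelSpace V]

lemma integral_exp_neg_mul_sq_mul_cos {b : ℝ} (hb : 0 < b) (β : V) (τ : ℝ) :
    ∫ v : V, Real.exp (-b * ‖v‖ ^ 2) * Real.cos (⟪β, v⟫_ℝ + τ) =
      (Real.pi / b) ^ (Module.finrank ℝ V / 2 : ℝ) * Real.exp (-‖β‖ ^ 2 / (4 * b)) *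
        Real.cos τ := by
  have hb' : 0 < (b : ℂ).re := hb
  have hint := GaussianFourier.integrable_cexp_neg_mul_sq_norm_add hb' Complex.I β
  have h := GaussianFourier.integral_cexp_neg_mul_sq_norm_add hb' Complex.I β
  have e : ∀ v : V, Real.exp (-b * ‖v‖ ^ 2) * Real.cos (⟪β, v⟫_ℝ + τ) =
      Complex.reCLM (Complex.exp (-b * ‖v‖ ^ 2 + Complex.I * ⟪β, v⟫_ℝ) *
        Complex.exp (τ * Complex.I)) := by
    intro v
    rw [← Complex.exp_add, show (-b * ‖v‖ ^ 2 + Complex.I * ⟪β, v⟫_ℝ + τ * Complex.I : ℂ) =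
      ((-b * ‖v‖ ^ 2 : ℝ) : ℂ) + ((⟪β, v⟫_ℝ + τ : ℝ) : ℂ) * Complex.I by push_cast; ring,
      Complex.exp_add, ← Complex.ofReal_exp, Complex.reCLM_apply, Complex.re_ofReal_mul,
      Complex.exp_ofReal_mul_I_re]
  simp_rw [e]
  rw [ContinuousLinearMap.integral_comp_comm _ (hint.mul_const _), integral_mul_const, h]
  have h1 : ((Real.pi : ℂ) / b) ^ (Module.finrank ℝ V / 2 : ℂ) =
      (((Real.pi / b) ^ (Module.finrank ℝ V / 2 : ℝ) : ℝ) : ℂ) := by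
    rw [Complex.ofReal_cpow (by positivity)]
    push_cast; rfl
  have h2 : Complex.exp (Complex.I ^ 2 * ‖β‖ ^ 2 / (4 * b)) =
      ((Real.exp (-‖β‖ ^ 2 / (4 * b)) : ℝ) : ℂ) := by
    rw [Complex.I_sq]; push_cast; ring_nf
  rw [h1, h2, ← Complex.ofReal_mul, Complex.reCLM_apply, Complex.re_ofReal_mul,
    Complex.exp_ofReal_mul_I_re]

lemma integrable_exp_neg_mul_sq {b : ℝ} (hb : 0 < b) (x : V) :
    Integrable fun v : V => Real.exp (-b * ‖v - x‖ ^ 2) := by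
  have h := (GaussianFourier.integrable_cexp_neg_mul_sq_norm_add
    (show 0 < (b : ℂ).re from hb) 0 (0 : V)).re
  have h' : Integrable fun v : V => Real.exp (-b * ‖v‖ ^ 2) := by
    refine h.congr (ae_of_all _ fun v => ?_)
    simp only [zero_mul, add_zero]
    rw [show (-b * ‖v‖ ^ 2 : ℂ) = ((-b * ‖v‖ ^ 2 : ℝ) : ℂ) by push_cast; ring,
      ← Complex.ofReal_exp]
    rfl
  exact h'.comp_sub_right x

end Gaussian

/-! ### Needles for the squared exponential kernel -/

/-- The feature of the point `x` for the squared exponential kernel: the Gaussian of half the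
variance, centred at `x` and normalized in `L²`. -/
def gaussFeature (l : ℝ) (x u : EuclideanSpace ℝ (Fin d)) : ℝ :=
  (√((Real.pi / (2 / l ^ 2)) ^ (d / 2 : ℝ)))⁻¹ * Real.exp (-(l ^ 2)⁻¹ * ‖u - x‖ ^ 2)

lemma memLp_gaussFeature {l : ℝ} (hl : 0 < l) (x : EuclideanSpace ℝ (Fin d)) :
    MemLp (gaussFeature l x) 2 := by
  have hcont : Continuous (gaussFeature l x) := by unfold gaussFeature; fun_prop
  rw [memLp_two_iff_integrable_sq hcont.aestronglyMeasurable]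
  simp only [gaussFeature, mul_pow, ← Real.exp_nat_mul]
  refine Integrable.const_mul ?_ _
  refine (integrable_exp_neg_mul_sq (b := 2 * (l ^ 2)⁻¹) (by positivity) x).congr
    (ae_of_all _ fun u => congrArg Real.exp ?_)
  push_cast; ring

/-- The product of two Gaussian features is a Gaussian around the midpoint of their centres, so the
integral is its Fourier transform at `2 β`. -/
lemma integral_gaussFeature_cos {l : ℝ} (hl : 0 < l) (x g β : EuclideanSpace ℝ (Fin d)) :
    ∫ u, gaussFeature l g u * Real.cos ⟪(2 : ℝ) • β, u - g⟫_ℝ * gaussFeature l x u =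
      Real.exp (-(‖β‖ ^ 2 * l ^ 2 / 2)) * (Real.exp (-‖x - g‖ ^ 2 / (2 * l ^ 2)) *
        Real.cos ⟪β, x - g⟫_ℝ) := by
  rw [← integral_add_right_eq_self _ ((2 : ℝ)⁻¹ • (x + g))]
  set A := (Real.pi / (2 / l ^ 2)) ^ (d / 2 : ℝ) with hA
  have hA0 : 0 < A := by positivity
  have e : ∀ v : EuclideanSpace ℝ (Fin d),
      gaussFeature l g (v + (2 : ℝ)⁻¹ • (x + g)) *
        Real.cos ⟪(2 : ℝ) • β, v + (2 : ℝ)⁻¹ • (x + g) - g⟫_ℝ *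
        gaussFeature l x (v + (2 : ℝ)⁻¹ • (x + g)) =
      A⁻¹ * Real.exp (-‖x - g‖ ^ 2 / (2 * l ^ 2)) *
        (Real.exp (-(2 / l ^ 2) * ‖v‖ ^ 2) *
          Real.cos (⟪(2 : ℝ) • β, v⟫_ℝ + ⟪β, x - g⟫_ℝ)) := by
    intro v
    obtain ⟨y, hy⟩ : ∃ y, y = (2 : ℝ)⁻¹ • (x - g) := ⟨_, rfl⟩
    have e1 : v + (2 : ℝ)⁻¹ • (x + g) - g = v + y := by rw [hy]; module
    have e2 : v + (2 : ℝ)⁻¹ • (x + g) - x = v - y := by rw [hy]; module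
    have e3 : x - g = (2 : ℝ) • y := by rw [hy]; module
    have e4 : ‖v + y‖ ^ 2 = 2 * ‖v‖ ^ 2 + 2 * ‖y‖ ^ 2 - ‖v - y‖ ^ 2 := by
      have := parallelogram_law_with_norm ℝ v y
      linarith
    have e5 : ‖x - g‖ ^ 2 = 4 * ‖y‖ ^ 2 := by
      rw [e3, norm_smul]; norm_num; ring
    have e6 : ⟪(2 : ℝ) • β, v + y⟫_ℝ = ⟪(2 : ℝ) • β, v⟫_ℝ + ⟪β, x - g⟫_ℝ := by
      rw [inner_add_right, real_inner_smul_left _ y, e3, real_inner_smul_right]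
    rw [gaussFeature, gaussFeature, e1, e2, e6, e5, ← hA]
    have e7 : Real.exp (-(l ^ 2)⁻¹ * ‖v + y‖ ^ 2) * Real.exp (-(l ^ 2)⁻¹ * ‖v - y‖ ^ 2) =
        Real.exp (-(4 * ‖y‖ ^ 2) / (2 * l ^ 2)) * Real.exp (-(2 / l ^ 2) * ‖v‖ ^ 2) := by
      rw [← Real.exp_add, ← Real.exp_add, e4]
      congr 1
      field_simp
      ring
    have e8 : (√A)⁻¹ * (√A)⁻¹ = A⁻¹ := by
      rw [← mul_inv, Real.mul_self_sqrt hA0.le]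
    linear_combination (√A)⁻¹ * (√A)⁻¹ * Real.cos (⟪(2 : ℝ) • β, v⟫_ℝ + ⟪β, x - g⟫_ℝ) * e7 +
      Real.exp (-(4 * ‖y‖ ^ 2) / (2 * l ^ 2)) * Real.exp (-(2 / l ^ 2) * ‖v‖ ^ 2) *
        Real.cos (⟪(2 : ℝ) • β, v⟫_ℝ + ⟪β, x - g⟫_ℝ) * e8
  simp_rw [e]
  rw [integral_const_mul, integral_exp_neg_mul_sq_mul_cos (by positivity), finrank_euclideanSpace,
    Fintype.card_fin, ← hA]
  have e9 : -‖(2 : ℝ) • β‖ ^ 2 / (4 * (2 / l ^ 2)) = -(‖β‖ ^ 2 * l ^ 2 / 2) := by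
    rw [norm_smul]
    norm_num
    field_simp
    ring
  rw [e9]
  field_simp

lemma integral_gaussFeature_mul {l : ℝ} (hl : 0 < l) (x y : Dom d) :
    ∫ u, gaussFeature l x.1 u * gaussFeature l y.1 u = kSE l x y := by
  have h := integral_gaussFeature_cos hl y.1 x.1 0
  simp only [smul_zero, inner_zero_left, Real.cos_zero, mul_one] at h
  rw [h, kSE, Subtype.dist_eq, dist_eq_norm, norm_sub_rev]
  simp

/-- A Gaussian times a trigonometric polynomial lies in the RKHS of the squared exponential
kernel; a frequency `β` costs a factor `exp (l² ‖β‖² / 2)` in norm. -/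
lemma gauss_mul_cos_mem_rkhsBall {l : ℝ} (hl : 0 < l) (g : Dom d) {P : Type*} (s : Finset P)
    (a : P → ℝ) (β : P → EuclideanSpace ℝ (Fin d)) :
    (fun x : Dom d => Real.exp (-‖x.1 - g.1‖ ^ 2 / (2 * l ^ 2)) *
      ∑ p ∈ s, a p * Real.cos ⟪β p, x.1 - g.1⟫_ℝ) ∈
    rkhsBall (kSE l) (∑ p ∈ s, |a p| * Real.exp (‖β p‖ ^ 2 * l ^ 2 / 2)) := by
  set N := ∑ p ∈ s, |a p| * Real.exp (‖β p‖ ^ 2 * l ^ 2 / 2) with hN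
  have hN0 : 0 ≤ N := Finset.sum_nonneg fun _ _ => by positivity
  set c : EuclideanSpace ℝ (Fin d) → ℝ := fun u =>
    ∑ p ∈ s, a p * Real.exp (‖β p‖ ^ 2 * l ^ 2 / 2) * Real.cos ⟪(2 : ℝ) • β p, u - g.1⟫_ℝ with hc
  have hcN : ∀ u, |c u| ≤ N := by
    intro u
    refine (Finset.abs_sum_le_sum_abs _ _).trans (Finset.sum_le_sum fun p _ => ?_)
    rw [abs_mul, abs_mul, Real.abs_exp]
    exact mul_le_of_le_one_right (by positivity) (Real.abs_cos_le_one _)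
  have hccont : Continuous c := by rw [hc]; fun_prop
  have hgcont : Continuous (gaussFeature l g.1) := by unfold gaussFeature; fun_prop
  have hg := memLp_gaussFeature hl g.1
  have hle : ∀ u, |gaussFeature l g.1 u * c u| ≤ N * |gaussFeature l g.1 u| := by
    intro u
    rw [abs_mul, mul_comm]
    exact mul_le_mul_of_nonneg_right (hcN u) (abs_nonneg _)
  have hw : MemLp (fun u => gaussFeature l g.1 u * c u) 2 :=
    hg.of_le_mul (hgcont.mul hccont).aestronglyMeasurable (c := N) (ae_of_all _ hle)
  have hkey := mem_rkhsBall_of_memLp (k := kSE l) volume (fun x : Dom d => gaussFeature l x.1)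
    (fun x => memLp_gaussFeature hl x.1) (integral_gaussFeature_mul hl) hw hN0 (by
      calc ∫ u, (gaussFeature l g.1 u * c u) ^ 2
          ≤ ∫ u, N ^ 2 * (gaussFeature l g.1 u * gaussFeature l g.1 u) := by
            refine integral_mono ?_ ((hg.integrable_mul hg).const_mul _) fun u => ?_
            · exact hw.integrable_sq
            · have := mul_self_le_mul_self (abs_nonneg _) (hle u)
              rw [abs_mul_abs_self] at this
              have h2 := abs_mul_abs_self (gaussFeature l g.1 u)
              simp only
              nlinarith
        _ = N ^ 2 := by
            rw [integral_const_mul, integral_gaussFeature_mul hl g g, kSE]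
            simp)
  refine (congrArg (· ∈ rkhsBall (kSE l) N) (funext fun x => ?_)).mp hkey
  have hterm : ∀ u, gaussFeature l g.1 u * c u * gaussFeature l x.1 u =
      ∑ p ∈ s, a p * Real.exp (‖β p‖ ^ 2 * l ^ 2 / 2) *
        (gaussFeature l g.1 u * Real.cos ⟪(2 : ℝ) • β p, u - g.1⟫_ℝ * gaussFeature l x.1 u) := by
    intro u
    rw [hc, Finset.mul_sum, Finset.sum_mul]
    exact Finset.sum_congr rfl fun p _ => by ring
  simp_rw [hterm]
  rw [integral_finsetSum]
  · rw [Finset.mul_sum]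
    refine Finset.sum_congr rfl fun p _ => ?_
    rw [integral_const_mul, integral_gaussFeature_cos hl, Real.exp_neg]
    field_simp
  · intro p _
    refine Integrable.const_mul
      (MemLp.integrable_mul (p := 2) (q := 2) ?_ (memLp_gaussFeature hl x.1)) _
    refine hg.of_le (hgcont.mul (by fun_prop)).aestronglyMeasurable (ae_of_all _ fun u => ?_)
    rw [norm_mul]
    exact mul_le_of_le_one_right (norm_nonneg _) (Real.abs_cos_le_one _)

/-- The vector with the coordinates `J i ∈ {0, …, n - 1}`. -/
def intVec {n : ℕ} (J : Fin d → Fin n) : EuclideanSpace ℝ (Fin d) :=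
  WithLp.toLp 2 fun i => ((J i : ℕ) : ℝ)

/-- The points of the domain with coordinates in `{0, 1/n, …, (n-1)/n}`. -/
def gridPoint {n : ℕ} (m : Fin d → Fin n) : Dom d :=
  ⟨WithLp.toLp 2 fun i => ((m i : ℕ) : ℝ) / n, fun i => by
    have h : ((m i : ℕ) : ℝ) ≤ n := by exact_mod_cast (m i).2.le
    exact ⟨by positivity, div_le_one_of_le₀ h (by positivity)⟩⟩

/-- Orthogonality of the characters of `(ℤ/n)^d`. -/
lemma sum_grid_cos {n : ℕ} (hn : n ≠ 0) (J K : Fin d → Fin n) (x : EuclideanSpace ℝ (Fin d)) :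
    ∑ m : Fin d → Fin n,
      Real.cos ⟪(2 * Real.pi) • (intVec J - intVec K), x - (gridPoint m).1⟫_ℝ =
      if J = K then (n : ℝ) ^ d else 0 := by
  split_ifs with h
  · simp [h]
  obtain ⟨i₀, hi₀⟩ := Function.ne_iff.1 h
  have hn' : (n : ℂ) ≠ 0 := by exact_mod_cast hn
  set z : Fin d → ℂ := fun i =>
    Complex.exp (-(2 * Real.pi * (((J i : ℕ) : ℂ) - (K i : ℕ)) / n * Complex.I)) with hz
  set q : ℝ := ⟪(2 * Real.pi) • (intVec J - intVec K), x⟫_ℝ with hq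
  have e : ∀ m : Fin d → Fin n,
      Real.cos ⟪(2 * Real.pi) • (intVec J - intVec K), x - (gridPoint m).1⟫_ℝ =
        (Complex.exp (q * Complex.I) * ∏ i, z i ^ (m i : ℕ)).re := by
    intro m
    rw [← Complex.exp_ofReal_mul_I_re, inner_sub_right, ← hq]
    congr 1
    simp only [hz, ← Complex.exp_nat_mul, ← Complex.exp_sum, ← Complex.exp_add]
    congr 1
    simp only [PiLp.inner_apply, PiLp.smul_apply, PiLp.sub_apply, intVec, gridPoint,
      RCLike.inner_apply, conj_trivial, smul_eq_mul]
    push_cast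
    rw [sub_mul, Finset.sum_mul, sub_eq_add_neg, ← Finset.sum_neg_distrib]
    congr 1
    refine Finset.sum_congr rfl fun i _ => ?_
    ring
  simp_rw [e]
  rw [← Complex.re_sum, ← Finset.mul_sum]
  have hprod : ∑ m : Fin d → Fin n, ∏ i, z i ^ (m i : ℕ) = ∏ i, ∑ j : Fin n, z i ^ (j : ℕ) := by
    rw [Finset.prod_univ_sum, Fintype.piFinset_univ]
  have hzero : ∑ j : Fin n, z i₀ ^ (j : ℕ) = 0 := by
    rw [Fin.sum_univ_eq_sum_range fun j => z i₀ ^ j]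
    have hz1 : z i₀ ≠ 1 := by
      intro h1
      rw [hz, Complex.exp_eq_one_iff] at h1
      obtain ⟨k, hk⟩ := h1
      have hpi : (Real.pi : ℂ) ≠ 0 := by exact_mod_cast Real.pi_ne_zero
      have h2 : ((K i₀ : ℕ) : ℂ) - (J i₀ : ℕ) = k * n := by
        have hI := Complex.I_ne_zero
        field_simp at hk
        linear_combination hk
      have h3 : ((K i₀ : ℕ) : ℤ) - (J i₀ : ℕ) = k * n := by exact_mod_cast h2
      have hJ := (J i₀).2
      have hK := (K i₀).2
      have hk0 : k = 0 := by
        by_contra hk0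
        have : (1 : ℤ) ≤ |k| := Int.one_le_abs hk0
        have h4 : |((K i₀ : ℕ) : ℤ) - (J i₀ : ℕ)| = |k| * n := by
          rw [h3, abs_mul, Nat.abs_cast]
        have h5 : |((K i₀ : ℕ) : ℤ) - (J i₀ : ℕ)| < n := by
          rw [abs_lt]; constructor <;> omega
        nlinarith
      rw [hk0, zero_mul] at h3
      exact hi₀ (Fin.ext (by omega))
    have hzn : z i₀ ^ n = 1 := by
      rw [hz, ← Complex.exp_nat_mul, Complex.exp_eq_one_iff]
      refine ⟨((K i₀ : ℕ) : ℤ) - (J i₀ : ℕ), ?_⟩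
      push_cast
      field_simp
      ring
    rw [geom_sum_eq hz1, hzn, sub_self, zero_div]
  rw [hprod, Finset.prod_eq_zero (Finset.mem_univ i₀) hzero, mul_zero, Complex.zero_re]

/-- The needle at the grid point `m / n`: a Gaussian times the Fejér-type kernel
`|n⁻ᵈ ∑_J exp (2πi⟨J, x - m/n⟩)|²`, `J ∈ {0, …, n - 1}ᵈ`, multiplied out. -/
def seNeedle (l : ℝ) {n : ℕ} (m : Fin d → Fin n) (x : Dom d) : ℝ :=
  Real.exp (-‖x.1 - (gridPoint m).1‖ ^ 2 / (2 * l ^ 2)) *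
    ∑ p : (Fin d → Fin n) × (Fin d → Fin n), (((n : ℝ) ^ d)⁻¹) ^ 2 *
      Real.cos ⟪(2 * Real.pi) • (intVec p.1 - intVec p.2), x.1 - (gridPoint m).1⟫_ℝ

lemma fejer_nonneg {n : ℕ} (y : EuclideanSpace ℝ (Fin d)) :
    0 ≤ ∑ p : (Fin d → Fin n) × (Fin d → Fin n), (((n : ℝ) ^ d)⁻¹) ^ 2 *
      Real.cos ⟪(2 * Real.pi) • (intVec p.1 - intVec p.2), y⟫_ℝ := by
  rw [← Finset.mul_sum]
  refine mul_nonneg (sq_nonneg _) ?_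
  have : ∑ p : (Fin d → Fin n) × (Fin d → Fin n),
      Real.cos ⟪(2 * Real.pi) • (intVec p.1 - intVec p.2), y⟫_ℝ =
      (∑ J : Fin d → Fin n, Real.cos ⟪(2 * Real.pi) • intVec J, y⟫_ℝ) ^ 2 +
      (∑ J : Fin d → Fin n, Real.sin ⟪(2 * Real.pi) • intVec J, y⟫_ℝ) ^ 2 := by
    simp only [smul_sub, inner_sub_left, Real.cos_sub, sq, Finset.sum_add_distrib,
      Fintype.sum_prod_type, Finset.sum_mul_sum]
  rw [this]
  positivity

lemma sum_const_inv_sq {n : ℕ} (hn : n ≠ 0) :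
    ∑ _p : (Fin d → Fin n) × (Fin d → Fin n), (((n : ℝ) ^ d)⁻¹) ^ 2 = 1 := by
  have hn' : (n : ℝ) ≠ 0 := by exact_mod_cast hn
  simp only [Finset.sum_const, Finset.card_univ, Fintype.card_prod, Fintype.card_pi,
    Fintype.card_fin, Finset.prod_const, nsmul_eq_mul]
  push_cast
  field_simp

lemma fejer_le_one {n : ℕ} (hn : n ≠ 0) (y : EuclideanSpace ℝ (Fin d)) :
    ∑ p : (Fin d → Fin n) × (Fin d → Fin n), (((n : ℝ) ^ d)⁻¹) ^ 2 *
      Real.cos ⟪(2 * Real.pi) • (intVec p.1 - intVec p.2), y⟫_ℝ ≤ 1 := by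
  rw [← sum_const_inv_sq (d := d) hn]
  exact Finset.sum_le_sum fun p _ => mul_le_of_le_one_right (sq_nonneg _) (Real.cos_le_one _)

lemma exp_neg_sq_div_le_one (l : ℝ) (y : EuclideanSpace ℝ (Fin d)) :
    Real.exp (-‖y‖ ^ 2 / (2 * l ^ 2)) ≤ 1 :=
  Real.exp_le_one_iff.2 (div_nonpos_of_nonpos_of_nonneg (by simp) (by positivity))

lemma seNeedle_nonneg (l : ℝ) {n : ℕ} (m : Fin d → Fin n) (x : Dom d) : 0 ≤ seNeedle l m x :=
  mul_nonneg (Real.exp_pos _).le (fejer_nonneg _)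

lemma seNeedle_le_one (l : ℝ) {n : ℕ} (hn : n ≠ 0) (m : Fin d → Fin n) (x : Dom d) :
    seNeedle l m x ≤ 1 :=
  mul_le_one₀ (exp_neg_sq_div_le_one _ _) (fejer_nonneg _) (fejer_le_one hn _)

lemma seNeedle_gridPoint (l : ℝ) {n : ℕ} (hn : n ≠ 0) (m : Fin d → Fin n) :
    seNeedle l m (gridPoint m) = 1 := by
  simp only [seNeedle, sub_self, inner_zero_right, Real.cos_zero, mul_one, norm_zero,
    sum_const_inv_sq hn]
  simp

lemma sum_seNeedle_le_one (l : ℝ) {n : ℕ} (hn : n ≠ 0) (x : Dom d) :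
    ∑ m : Fin d → Fin n, seNeedle l m x ≤ 1 := by
  have hn' : (n : ℝ) ≠ 0 := by exact_mod_cast hn
  calc ∑ m : Fin d → Fin n, seNeedle l m x
      ≤ ∑ m : Fin d → Fin n, ∑ p : (Fin d → Fin n) × (Fin d → Fin n), (((n : ℝ) ^ d)⁻¹) ^ 2 *
        Real.cos ⟪(2 * Real.pi) • (intVec p.1 - intVec p.2), x.1 - (gridPoint m).1⟫_ℝ :=
        Finset.sum_le_sum fun m _ =>
          mul_le_of_le_one_left (fejer_nonneg _) (exp_neg_sq_div_le_one _ _)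
    _ = 1 := by
        rw [Finset.sum_comm]
        simp_rw [← Finset.mul_sum, sum_grid_cos hn, Fintype.sum_prod_type]
        simp only [Finset.sum_ite_eq, Finset.mem_univ, if_true, Finset.sum_const,
          Finset.card_univ, Fintype.card_pi, Fintype.card_fin, Finset.prod_const, nsmul_eq_mul]
        push_cast
        field_simp

lemma norm_sq_intVec_sub_le {n : ℕ} (J K : Fin d → Fin n) :
    ‖intVec J - intVec K‖ ^ 2 ≤ d * (n : ℝ) ^ 2 := by
  rw [EuclideanSpace.norm_sq_eq]
  calc ∑ i, ‖(intVec J - intVec K) i‖ ^ 2 ≤ ∑ _i : Fin d, (n : ℝ) ^ 2 := by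
        refine Finset.sum_le_sum fun i _ => ?_
        have hJ : ((J i : ℕ) : ℝ) ≤ n := by exact_mod_cast (J i).2.le
        have hK : ((K i : ℕ) : ℝ) ≤ n := by exact_mod_cast (K i).2.le
        have hJ0 : (0 : ℝ) ≤ ((J i : ℕ) : ℝ) := by positivity
        have hK0 : (0 : ℝ) ≤ ((K i : ℕ) : ℝ) := by positivity
        simp only [PiLp.sub_apply, intVec, Real.norm_eq_abs]
        refine pow_le_pow_left₀ (abs_nonneg _) ?_ 2
        rw [abs_le]; constructor <;> linarith
    _ = d * (n : ℝ) ^ 2 := by simp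

lemma seNeedle_mem_rkhsBall {l : ℝ} (hl : 0 < l) {n : ℕ} (hn : n ≠ 0) (m : Fin d → Fin n) :
    seNeedle l m ∈ rkhsBall (kSE l) (Real.exp (2 * Real.pi ^ 2 * l ^ 2 * d * (n : ℝ) ^ 2)) := by
  have h := gauss_mul_cos_mem_rkhsBall hl (gridPoint m) Finset.univ
    (fun _ : (Fin d → Fin n) × (Fin d → Fin n) => (((n : ℝ) ^ d)⁻¹) ^ 2)
    (fun p => (2 * Real.pi) • (intVec p.1 - intVec p.2))
  have h2 := rkhsBall_smul zero_le_one h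
    (B := Real.exp (2 * Real.pi ^ 2 * l ^ 2 * d * (n : ℝ) ^ 2)) ?_
  · simp only [one_mul] at h2
    exact h2
  rw [one_mul]
  calc _ ≤ ∑ _p : (Fin d → Fin n) × (Fin d → Fin n), (((n : ℝ) ^ d)⁻¹) ^ 2 *
        Real.exp (2 * Real.pi ^ 2 * l ^ 2 * d * (n : ℝ) ^ 2) := by
        refine Finset.sum_le_sum fun p _ => ?_
        rw [abs_of_nonneg (sq_nonneg _)]
        refine mul_le_mul_of_nonneg_left (Real.exp_le_exp.2 ?_) (sq_nonneg _)
        rw [norm_smul, Real.norm_of_nonneg (by positivity)]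
        have := mul_le_mul_of_nonneg_left (norm_sq_intVec_sub_le p.1 p.2)
          (show 0 ≤ 2 * Real.pi ^ 2 * l ^ 2 by positivity)
        nlinarith
    _ = _ := by rw [← Finset.sum_mul, sum_const_inv_sq hn, one_mul]

/-! ### The Matérn kernel as a mixture of Gaussian kernels -/

open ProbabilityTheory Set in
lemma integral_gammaMeasure {ν : ℝ} (hν : 0 < ν) (f : ℝ → ℝ) :
    ∫ s, f s ∂gammaMeasure ν 1 =
      (Real.Gamma ν)⁻¹ * ∫ s in Ioi (0 : ℝ), Real.exp (-s) * s ^ (ν - 1) * f s := by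
  have hmeas : Measurable (gammaPDF ν 1) := (measurable_gammaPDFReal ν 1).ennreal_ofReal
  rw [gammaMeasure, integral_withDensity_eq_integral_toReal_smul hmeas
    (ae_of_all _ fun _ => ENNReal.ofReal_lt_top), ← integral_const_mul]
  have h : ∀ s, (gammaPDF ν 1 s).toReal = gammaPDFReal ν 1 s := fun s =>
    ENNReal.toReal_ofReal (gammaPDFReal_nonneg hν one_pos s)
  simp_rw [h, smul_eq_mul]
  rw [← setIntegral_eq_integral_of_forall_compl_eq_zero (s := Ici 0),
    integral_Ici_eq_integral_Ioi]
  · refine setIntegral_congr_fun measurableSet_Ioi fun s hs => ?_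
    simp only [gammaPDFReal, if_pos (le_of_lt (mem_Ioi.1 hs)), Real.one_rpow, one_mul]
    ring
  · intro s hs
    rw [gammaPDFReal, if_neg (by simpa using hs), zero_mul]

lemma ae_pos_gammaMeasure (ν : ℝ) : ∀ᵐ s ∂ProbabilityTheory.gammaMeasure ν 1, 0 < s := by
  have hmeas : Measurable (ProbabilityTheory.gammaPDF ν 1) :=
    (ProbabilityTheory.measurable_gammaPDFReal ν 1).ennreal_ofReal
  rw [ProbabilityTheory.gammaMeasure, ae_withDensity_iff hmeas]
  filter_upwards [Measure.ae_ne volume (0 : ℝ)] with s hs h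
  by_contra hs'
  exact h (ProbabilityTheory.gammaPDF_of_neg (lt_of_le_of_ne (not_lt.1 hs') hs))

open Set in
/-- The Bessel function as a Laplace-type integral, by the substitution `s = (z/2) eᵗ` in the
integral on the left. -/
lemma integral_exp_neg_mul_rpow_mul_exp_neg_div {ν z : ℝ} (hν : 0 < ν) (hz : 0 < z) :
    ∫ s in Ioi (0 : ℝ), Real.exp (-s) * s ^ (ν - 1) * Real.exp (-(z ^ 2 / (4 * s))) =
      2 * (z / 2) ^ ν * besselK ν z := by
  set F : ℝ → ℝ := fun s => Real.exp (-s) * s ^ (ν - 1) * Real.exp (-(z ^ 2 / (4 * s))) with hF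
  set h : ℝ → ℝ := fun t => Real.exp (-z * Real.cosh t) * Real.exp (ν * t) with hh
  have himg : (fun t => z / 2 * Real.exp t) '' univ = Ioi 0 := by
    ext s
    simp only [image_univ, mem_range, mem_Ioi]
    constructor
    · rintro ⟨t, rfl⟩; positivity
    · intro hs
      refine ⟨Real.log (s / (z / 2)), ?_⟩
      rw [Real.exp_log (by positivity)]
      field_simp
  have hderiv : ∀ t ∈ (univ : Set ℝ), HasDerivWithinAt (fun t => z / 2 * Real.exp t)
      (z / 2 * Real.exp t) univ t := fun t _ =>
    ((Real.hasDerivAt_exp t).const_mul _).hasDerivWithinAt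
  have hinj : InjOn (fun t => z / 2 * Real.exp t) univ := by
    intro a _ b _ hab
    exact Real.exp_injective (mul_left_cancel₀ (by positivity) hab)
  have hsub : ∀ t, |z / 2 * Real.exp t| • F (z / 2 * Real.exp t) = (z / 2) ^ ν * h t := by
    intro t
    have hpos : 0 < z / 2 * Real.exp t := by positivity
    rw [abs_of_pos hpos, smul_eq_mul, hF, hh]
    simp only
    have e1 : z / 2 * Real.exp t * (z / 2 * Real.exp t) ^ (ν - 1) =
        (z / 2) ^ ν * Real.exp (ν * t) := by
      rw [Real.rpow_sub_one hpos.ne', mul_div_cancel₀ _ hpos.ne',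
        Real.mul_rpow (by positivity) (Real.exp_pos _).le, ← Real.exp_mul, mul_comm t]
    have e2 : Real.exp (-(z / 2 * Real.exp t)) * Real.exp (-(z ^ 2 / (4 * (z / 2 * Real.exp t))))
        = Real.exp (-z * Real.cosh t) := by
      rw [← Real.exp_add, Real.cosh_eq, Real.exp_neg]
      congr 1
      field_simp
      ring
    rw [← e2]
    linear_combination Real.exp (-(z / 2 * Real.exp t)) *
      Real.exp (-(z ^ 2 / (4 * (z / 2 * Real.exp t)))) * e1
  have hFint : IntegrableOn F (Ioi 0) := by
    refine (Real.GammaIntegral_convergent hν).mul_bdd (c := 1) ?_ ?_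
    · exact (by fun_prop : Measurable fun s : ℝ =>
        Real.exp (-(z ^ 2 / (4 * s)))).aestronglyMeasurable
    · refine (ae_restrict_mem measurableSet_Ioi).mono fun s hs => ?_
      have hs' : 0 < s := hs
      rw [Real.norm_of_nonneg (Real.exp_pos _).le]
      exact Real.exp_le_one_iff.2 (neg_nonpos.2 (by positivity))
  have hhint : Integrable h := by
    have h1 := (integrableOn_image_iff_integrableOn_abs_deriv_smul MeasurableSet.univ hderiv hinj
      F).1 (himg ▸ hFint)
    simp_rw [hsub] at h1
    rw [integrableOn_univ] at h1
    have hc : (z / 2) ^ ν ≠ 0 := by positivity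
    exact (integrable_const_mul_iff (IsUnit.mk0 _ hc) h).1 h1
  have hsymm : ∫ t, h t = 2 * besselK ν z := by
    have h1 : ∫ t, h t = ∫ t, (h t + h (-t)) / 2 := by
      rw [integral_div, integral_add hhint hhint.comp_neg, integral_neg_eq_self]
      ring
    rw [h1, besselK, ← integral_comp_abs
      (f := fun t => Real.exp (-z * Real.cosh t) * Real.cosh (ν * t))]
    refine integral_congr_ae (ae_of_all _ fun t => ?_)
    have e3 : Real.cosh (ν * |t|) = Real.cosh (ν * t) := by
      rw [← Real.cosh_abs (ν * t), abs_mul, abs_of_pos hν]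
    simp only [hh, Real.cosh_abs, Real.cosh_neg, e3]
    rw [Real.cosh_eq (ν * t)]
    ring_nf
  rw [← himg, integral_image_eq_integral_abs_deriv_smul MeasurableSet.univ hderiv hinj]
  rw [setIntegral_univ, integral_congr_ae (ae_of_all _ hsub), integral_const_mul, hsymm]
  ring

/-- The Matérn kernel is a mixture of Gaussian kernels, whose squared length-scales are gamma
distributed. -/
lemma kMatern_eq_integral {l ν : ℝ} (hl : 0 < l) (hν : 0 < ν) (x y : Dom d) :
    kMatern l ν x y =
      ∫ s, Real.exp (-(ν * dist x y ^ 2 / (2 * l ^ 2 * s))) ∂ProbabilityTheory.gammaMeasure ν 1 := by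
  have := ProbabilityTheory.isProbabilityMeasure_gammaMeasure hν one_pos
  rw [kMatern]
  split_ifs with h
  · simp [h]
  have hr : 0 < dist x y := lt_of_le_of_ne dist_nonneg (Ne.symm h)
  set z := √(2 * ν) * dist x y / l with hz
  have hz0 : 0 < z := by positivity
  have hz2 : ∀ s, ν * dist x y ^ 2 / (2 * l ^ 2 * s) = z ^ 2 / (4 * s) := by
    intro s
    rw [hz, div_pow, mul_pow, Real.sq_sqrt (by positivity)]
    rcases eq_or_ne s 0 with rfl | hs
    · simp
    field_simp
    ring
  simp_rw [hz2]
  rw [integral_gammaMeasure hν, integral_exp_neg_mul_rpow_mul_exp_neg_div hν hz0,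
    Real.div_rpow hz0.le zero_le_two, Real.rpow_sub two_pos, Real.rpow_one]
  field_simp

/-! ### Needles for the Matérn kernel -/

open ProbabilityTheory in
/-- For real features of the Gaussian kernel, `cos + sin` can replace the complex exponential,
since the sine of the sum of the phases has mean zero. -/
lemma integral_stdGaussian_cos_add_sin (x y : EuclideanSpace ℝ (Fin d)) :
    ∫ ξ, (Real.cos ⟪ξ, x⟫_ℝ + Real.sin ⟪ξ, x⟫_ℝ) * (Real.cos ⟪ξ, y⟫_ℝ + Real.sin ⟪ξ, y⟫_ℝ)
      ∂stdGaussian (EuclideanSpace ℝ (Fin d)) = Real.exp (-‖x - y‖ ^ 2 / 2) := by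
  have hint : ∀ t : EuclideanSpace ℝ (Fin d), Integrable
      (fun ξ => Complex.exp (⟪ξ, t⟫_ℝ * Complex.I)) (stdGaussian (EuclideanSpace ℝ (Fin d))) := by
    intro t
    refine Integrable.of_bound (by fun_prop) 1 (ae_of_all _ fun ξ => ?_)
    rw [Complex.norm_exp_ofReal_mul_I]
  have hchar : ∀ t : EuclideanSpace ℝ (Fin d),
      ∫ ξ, Complex.exp (⟪ξ, t⟫_ℝ * Complex.I) ∂stdGaussian (EuclideanSpace ℝ (Fin d)) =
        ((Real.exp (-‖t‖ ^ 2 / 2) : ℝ) : ℂ) := by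
    intro t
    rw [← charFun_apply, charFun_stdGaussian]
    push_cast; rfl
  have hcosI : ∀ t : EuclideanSpace ℝ (Fin d), Integrable
      (fun ξ => Real.cos ⟪ξ, t⟫_ℝ) (stdGaussian (EuclideanSpace ℝ (Fin d))) := fun t =>
    (hint t).re.congr (ae_of_all _ fun ξ => Complex.exp_ofReal_mul_I_re _)
  have hsinI : ∀ t : EuclideanSpace ℝ (Fin d), Integrable
      (fun ξ => Real.sin ⟪ξ, t⟫_ℝ) (stdGaussian (EuclideanSpace ℝ (Fin d))) := fun t =>
    (hint t).im.congr (ae_of_all _ fun ξ => Complex.exp_ofReal_mul_I_im _)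
  have hcos : ∀ t : EuclideanSpace ℝ (Fin d),
      ∫ ξ, Real.cos ⟪ξ, t⟫_ℝ ∂stdGaussian (EuclideanSpace ℝ (Fin d)) =
        Real.exp (-‖t‖ ^ 2 / 2) := by
    intro t
    have := Complex.reCLM.integral_comp_comm (hint t)
    simp only [Complex.reCLM_apply, Complex.exp_ofReal_mul_I_re, hchar, Complex.ofReal_re] at this
    exact this
  have hsin : ∀ t : EuclideanSpace ℝ (Fin d),
      ∫ ξ, Real.sin ⟪ξ, t⟫_ℝ ∂stdGaussian (EuclideanSpace ℝ (Fin d)) = 0 := by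
    intro t
    have := Complex.imCLM.integral_comp_comm (hint t)
    simp only [Complex.imCLM_apply, Complex.exp_ofReal_mul_I_im, hchar, Complex.ofReal_im] at this
    exact this
  have e : ∀ ξ : EuclideanSpace ℝ (Fin d),
      (Real.cos ⟪ξ, x⟫_ℝ + Real.sin ⟪ξ, x⟫_ℝ) * (Real.cos ⟪ξ, y⟫_ℝ + Real.sin ⟪ξ, y⟫_ℝ) =
        Real.cos ⟪ξ, x - y⟫_ℝ + Real.sin ⟪ξ, x + y⟫_ℝ := by
    intro ξ
    rw [inner_sub_right, inner_add_right, Real.cos_sub, Real.sin_add]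
    ring
  simp_rw [e]
  rw [integral_add (hcosI _) (hsinI _), hcos, hsin, add_zero]

/-- The feature of the point `x` for the Matérn kernel: a random wave with a Gaussian frequency
`ξ`, whose scale depends on the gamma distributed first component. -/
def maternFeature (l ν : ℝ) (x : EuclideanSpace ℝ (Fin d)) (p : ℝ × EuclideanSpace ℝ (Fin d)) :
    ℝ :=
  Real.cos ⟪p.2, (√(ν / (l ^ 2 * p.1))) • x⟫_ℝ + Real.sin ⟪p.2, (√(ν / (l ^ 2 * p.1))) • x⟫_ℝ

lemma measurable_maternFeature (l ν : ℝ) (x : EuclideanSpace ℝ (Fin d)) :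
    Measurable (maternFeature l ν x) := by
  unfold maternFeature
  simp_rw [inner_smul_right]
  fun_prop

lemma abs_maternFeature_le (l ν : ℝ) (x : EuclideanSpace ℝ (Fin d))
    (p : ℝ × EuclideanSpace ℝ (Fin d)) : |maternFeature l ν x p| ≤ 2 := by
  refine (abs_add_le _ _).trans ?_
  linarith [Real.abs_cos_le_one ⟪p.2, (√(ν / (l ^ 2 * p.1))) • x⟫_ℝ,
    Real.abs_sin_le_one ⟪p.2, (√(ν / (l ^ 2 * p.1))) • x⟫_ℝ]

open ProbabilityTheory in
lemma integral_maternFeature_mul {l ν : ℝ} (hl : 0 < l) (hν : 0 < ν) {ψ : ℝ → ℝ}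
    (hψ : Measurable ψ) {R : ℝ} (hR : ∀ s, |ψ s| ≤ R) (x y : EuclideanSpace ℝ (Fin d)) :
    ∫ p, ψ p.1 * (maternFeature l ν x p * maternFeature l ν y p)
      ∂(gammaMeasure ν 1).prod (stdGaussian (EuclideanSpace ℝ (Fin d))) =
    ∫ s, ψ s * Real.exp (-(ν * dist x y ^ 2 / (2 * l ^ 2 * s))) ∂gammaMeasure ν 1 := by
  have := isProbabilityMeasure_gammaMeasure hν one_pos
  rw [integral_prod]
  · refine integral_congr_ae ?_
    filter_upwards [ae_pos_gammaMeasure ν] with s hs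
    rw [integral_const_mul]
    simp only [maternFeature]
    rw [integral_stdGaussian_cos_add_sin, ← smul_sub, norm_smul, mul_pow, dist_eq_norm,
      Real.norm_of_nonneg (Real.sqrt_nonneg _), Real.sq_sqrt (by positivity)]
    congr 2
    field_simp
  · refine Integrable.of_bound ?_ (R * (2 * 2)) (ae_of_all _ fun p => ?_)
    · exact ((hψ.comp measurable_fst).mul ((measurable_maternFeature l ν x).mul
        (measurable_maternFeature l ν y))).aestronglyMeasurable
    · rw [norm_mul, norm_mul]
      have hR0 : 0 ≤ R := (abs_nonneg _).trans (hR 0)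
      exact mul_le_mul (hR _) (mul_le_mul (abs_maternFeature_le ..) (abs_maternFeature_le ..)
        (norm_nonneg _) zero_le_two) (by positivity) hR0

/-- The needle of width about `√s₀` at `g`: the part of the mixture of Gaussians with squared
length-scales in `[s₀, 2 s₀]`, normalized to height `1`. -/
def maternNeedle (l ν s₀ : ℝ) (g x : Dom d) : ℝ :=
  ((ProbabilityTheory.gammaMeasure ν 1).real (Set.Icc s₀ (2 * s₀)))⁻¹ *
    ∫ s in Set.Icc s₀ (2 * s₀), Real.exp (-(ν * dist x g ^ 2 / (2 * l ^ 2 * s)))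
      ∂ProbabilityTheory.gammaMeasure ν 1

open ProbabilityTheory in
lemma le_gammaMeasure_real_Icc {ν s₀ : ℝ} (hν : 0 < ν) (hs₀ : 0 < s₀) (hs₁ : s₀ ≤ 1) :
    (Real.Gamma ν)⁻¹ * Real.exp (-2) * s₀ ^ ν / 2 ≤
      (gammaMeasure ν 1).real (Set.Icc s₀ (2 * s₀)) := by
  have := isProbabilityMeasure_gammaMeasure hν one_pos
  have hG := Real.Gamma_pos_of_pos hν
  rw [measureReal_def, ← ENNReal.ofReal_le_iff_le_toReal (measure_ne_top _ _), gammaMeasure,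
    withDensity_apply _ measurableSet_Icc]
  set c := (Real.Gamma ν)⁻¹ * Real.exp (-2) * s₀ ^ ν / (2 * s₀) with hc
  have hc0 : 0 ≤ c := by positivity
  calc ENNReal.ofReal ((Real.Gamma ν)⁻¹ * Real.exp (-2) * s₀ ^ ν / 2)
      = ∫⁻ _s in Set.Icc s₀ (2 * s₀), ENNReal.ofReal c := by
        rw [setLIntegral_const, Real.volume_Icc, ← ENNReal.ofReal_mul hc0]
        congr 1
        rw [hc]
        field_simp
        ring
    _ ≤ ∫⁻ s in Set.Icc s₀ (2 * s₀), gammaPDF ν 1 s := by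
        refine setLIntegral_mono' measurableSet_Icc fun s hs => ?_
        have hs0 : 0 < s := hs₀.trans_le hs.1
        rw [gammaPDF_of_nonneg hs0.le]
        refine ENNReal.ofReal_le_ofReal ?_
        rw [Real.one_rpow, one_div, one_mul, Real.rpow_sub_one hs0.ne', hc]
        have h1 : s₀ ^ ν ≤ s ^ ν := Real.rpow_le_rpow hs₀.le hs.1 hν.le
        have h2 : Real.exp (-2) ≤ Real.exp (-s) := Real.exp_le_exp.2 (by linarith [hs.2])
        have h3 : s₀ ^ ν / (2 * s₀) ≤ s ^ ν / s :=
          div_le_div₀ (by positivity) h1 hs0 hs.2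
        calc (Real.Gamma ν)⁻¹ * Real.exp (-2) * s₀ ^ ν / (2 * s₀)
            = (Real.Gamma ν)⁻¹ * (s₀ ^ ν / (2 * s₀)) * Real.exp (-2) := by ring
          _ ≤ (Real.Gamma ν)⁻¹ * (s ^ ν / s) * Real.exp (-s) := by gcongr

lemma gammaMeasure_real_Icc_pos {ν s₀ : ℝ} (hν : 0 < ν) (hs₀ : 0 < s₀) (hs₁ : s₀ ≤ 1) :
    0 < (ProbabilityTheory.gammaMeasure ν 1).real (Set.Icc s₀ (2 * s₀)) := by
  refine lt_of_lt_of_le ?_ (le_gammaMeasure_real_Icc hν hs₀ hs₁)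
  have := Real.Gamma_pos_of_pos hν
  positivity

lemma maternNeedle_nonneg (l ν s₀ : ℝ) (g x : Dom d) : 0 ≤ maternNeedle l ν s₀ g x :=
  mul_nonneg (inv_nonneg.2 measureReal_nonneg) (integral_nonneg fun _ => (Real.exp_pos _).le)

lemma maternNeedle_self {l ν s₀ : ℝ} (hν : 0 < ν) (hs₀ : 0 < s₀) (hs₁ : s₀ ≤ 1) (g : Dom d) :
    maternNeedle l ν s₀ g g = 1 := by
  simp [maternNeedle, inv_mul_cancel₀ (gammaMeasure_real_Icc_pos hν hs₀ hs₁).ne']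

lemma maternNeedle_le {l ν s₀ : ℝ} (hl : 0 < l) (hν : 0 < ν) (hs₀ : 0 < s₀) (hs₁ : s₀ ≤ 1)
    (g x : Dom d) :
    maternNeedle l ν s₀ g x ≤ Real.exp (-(ν * dist x g ^ 2 / (4 * l ^ 2 * s₀))) := by
  have := ProbabilityTheory.isProbabilityMeasure_gammaMeasure hν one_pos
  have hm := gammaMeasure_real_Icc_pos hν hs₀ hs₁
  rw [maternNeedle, inv_mul_le_iff₀ hm]
  calc ∫ s in Set.Icc s₀ (2 * s₀), Real.exp (-(ν * dist x g ^ 2 / (2 * l ^ 2 * s)))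
        ∂ProbabilityTheory.gammaMeasure ν 1
      ≤ ∫ _s in Set.Icc s₀ (2 * s₀), Real.exp (-(ν * dist x g ^ 2 / (4 * l ^ 2 * s₀)))
        ∂ProbabilityTheory.gammaMeasure ν 1 := by
        have hle : ∀ s ∈ Set.Icc s₀ (2 * s₀), Real.exp (-(ν * dist x g ^ 2 / (2 * l ^ 2 * s))) ≤
            Real.exp (-(ν * dist x g ^ 2 / (4 * l ^ 2 * s₀))) := by
          intro s hs
          have hs0 : 0 < s := hs₀.trans_le hs.1
          refine Real.exp_le_exp.2 (neg_le_neg (div_le_div_of_nonneg_left (by positivity)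
            (by positivity) ?_))
          nlinarith [hs.2, sq_nonneg l]
        refine setIntegral_mono_on ?_ (integrable_const _).integrableOn measurableSet_Icc hle
        refine Integrable.of_bound (by fun_prop : Measurable fun s : ℝ =>
          Real.exp (-(ν * dist x g ^ 2 / (2 * l ^ 2 * s)))).aestronglyMeasurable
          (Real.exp (-(ν * dist x g ^ 2 / (4 * l ^ 2 * s₀))))
          ((ae_restrict_mem measurableSet_Icc).mono fun s hs => ?_)
        rw [Real.norm_of_nonneg (Real.exp_pos _).le]
        exact hle s hs
    _ = _ := by rw [setIntegral_const, smul_eq_mul]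

open ProbabilityTheory in
lemma maternNeedle_mem_rkhsBall {l ν s₀ N : ℝ} (hl : 0 < l) (hν : 0 < ν) (hs₀ : 0 < s₀)
    (hs₁ : s₀ ≤ 1) (g : Dom d) (hN : 0 ≤ N)
    (hN2 : 2 * Real.Gamma ν * Real.exp 2 * s₀⁻¹ ^ ν ≤ N ^ 2) :
    maternNeedle l ν s₀ g ∈ rkhsBall (kMatern l ν) N := by
  have := isProbabilityMeasure_gammaMeasure hν one_pos
  have hm := gammaMeasure_real_Icc_pos hν hs₀ hs₁
  set S := Set.Icc s₀ (2 * s₀) with hS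
  set a := (gammaMeasure ν 1).real S with ha
  set ψ : ℝ → ℝ := S.indicator fun _ => a⁻¹ with hψ
  have hψm : Measurable ψ := measurable_const.indicator measurableSet_Icc
  have hψR : ∀ s, |ψ s| ≤ a⁻¹ := by
    intro s
    rw [hψ, Set.indicator_apply]
    split_ifs
    · rw [abs_of_pos (by positivity)]
    · rw [abs_zero]; positivity
  have hφm : ∀ x : Dom d, MemLp (maternFeature l ν x.1) 2
      ((gammaMeasure ν 1).prod (stdGaussian (EuclideanSpace ℝ (Fin d)))) := fun x =>
    MemLp.of_bound (measurable_maternFeature l ν x.1).aestronglyMeasurable 2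
      (ae_of_all _ (abs_maternFeature_le l ν x.1))
  have hker : ∀ x y : Dom d, ∫ p, maternFeature l ν x.1 p * maternFeature l ν y.1 p
      ∂(gammaMeasure ν 1).prod (stdGaussian (EuclideanSpace ℝ (Fin d))) = kMatern l ν x y := by
    intro x y
    have h := integral_maternFeature_mul hl hν (ψ := fun _ => 1) measurable_const (R := 1)
      (by simp) x.1 y.1
    simp only [one_mul] at h
    rw [h, kMatern_eq_integral hl hν]
    rfl
  have hw : MemLp (fun p : ℝ × EuclideanSpace ℝ (Fin d) => ψ p.1 * maternFeature l ν g.1 p) 2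
      ((gammaMeasure ν 1).prod (stdGaussian (EuclideanSpace ℝ (Fin d)))) := by
    refine MemLp.of_bound ((hψm.comp measurable_fst).mul
      (measurable_maternFeature l ν g.1)).aestronglyMeasurable (a⁻¹ * 2) (ae_of_all _ fun p => ?_)
    rw [norm_mul]
    exact mul_le_mul (hψR _) (abs_maternFeature_le ..) (norm_nonneg _) (by positivity)
  have hkey := mem_rkhsBall_of_memLp (k := kMatern l ν) _
    (fun x : Dom d => maternFeature l ν x.1) hφm hker hw hN ?_
  · refine (congrArg (· ∈ rkhsBall (kMatern l ν) N) (funext fun x => ?_)).mp hkey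
    have h := integral_maternFeature_mul hl hν hψm hψR g.1 x.1
    simp only [← mul_assoc] at h
    rw [h, maternNeedle, ← integral_const_mul, ← integral_indicator measurableSet_Icc]
    refine integral_congr_ae (ae_of_all _ fun s => ?_)
    simp only [hψ, Set.indicator_apply, ← hS]
    split_ifs
    · rw [dist_comm g.1]; rfl
    · rw [zero_mul]
  · have h := integral_maternFeature_mul hl hν (ψ := fun s => ψ s ^ 2) (hψm.pow_const 2)
      (R := a⁻¹ ^ 2) (fun s => by
        rw [abs_pow]; exact pow_le_pow_left₀ (abs_nonneg _) (hψR s) 2) g.1 g.1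
    have e : ∀ p : ℝ × EuclideanSpace ℝ (Fin d), (ψ p.1 * maternFeature l ν g.1 p) ^ 2 =
        ψ p.1 ^ 2 * (maternFeature l ν g.1 p * maternFeature l ν g.1 p) := fun p => by ring
    simp_rw [e]
    rw [h]
    have e2 : ∀ s, ψ s ^ 2 * Real.exp (-(ν * dist g.1 g.1 ^ 2 / (2 * l ^ 2 * s))) =
        S.indicator (fun _ => a⁻¹ ^ 2) s := by
      intro s
      simp only [hψ, Set.indicator_apply]
      split_ifs <;> simp
    simp_rw [e2]
    rw [integral_indicator measurableSet_Icc, setIntegral_const, smul_eq_mul, ← ha]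
    refine le_trans ?_ hN2
    have hG := Real.Gamma_pos_of_pos hν
    have hlow := le_gammaMeasure_real_Icc hν hs₀ hs₁
    rw [← hS, ← ha] at hlow
    calc a * a⁻¹ ^ 2 = a⁻¹ := by field_simp
      _ ≤ ((Real.Gamma ν)⁻¹ * Real.exp (-2) * s₀ ^ ν / 2)⁻¹ :=
        inv_anti₀ (by positivity) hlow
      _ = 2 * Real.Gamma ν * Real.exp 2 * s₀⁻¹ ^ ν := by
        rw [Real.inv_rpow hs₀.le, Real.exp_neg]
        field_simp

/-- The sums of a Gaussian over translates of the integers are bounded uniformly. -/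
lemma exists_sum_exp_neg_mul_sq_le {α : ℝ} (hα : 0 < α) :
    ∃ K : ℝ, 0 < K ∧ ∀ (n : ℕ) (y : ℝ),
      ∑ j : Fin n, Real.exp (-(α * (y - (j : ℕ)) ^ 2)) ≤ K := by
  set r := Real.exp (-(α / 2)) with hr
  have hr0 : 0 < r := Real.exp_pos _
  have hr1 : r < 1 := Real.exp_lt_one_iff.2 (by linarith)
  have hs : Summable fun k : ℤ => r ^ k.natAbs := by
    refine Summable.of_nat_of_neg ?_ ?_ <;> simpa using summable_geometric_of_lt_one hr0.le hr1
  refine ⟨Real.exp α * ∑' k : ℤ, r ^ k.natAbs, ?_, fun n y => ?_⟩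
  · exact mul_pos (Real.exp_pos _) (hs.tsum_pos (fun k => by positivity) 0 (by simp))
  · have hinj : Function.Injective fun j : Fin n => ((j : ℕ) : ℤ) - ⌊y⌋ := by
      intro i j hij
      have : ((i : ℕ) : ℤ) = (j : ℕ) := by simpa using hij
      exact Fin.ext (by exact_mod_cast this)
    calc ∑ j : Fin n, Real.exp (-(α * (y - (j : ℕ)) ^ 2))
        ≤ ∑ j : Fin n, Real.exp α * r ^ (((j : ℕ) : ℤ) - ⌊y⌋).natAbs := by
          refine Finset.sum_le_sum fun j _ => ?_
          set k : ℤ := ((j : ℕ) : ℤ) - ⌊y⌋ with hk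
          rw [hr, ← Real.exp_nat_mul, ← Real.exp_add]
          refine Real.exp_le_exp.2 ?_
          have h1 : ((k.natAbs : ℕ) : ℝ) ≤ (k : ℝ) ^ 2 := by
            have : k.natAbs ≤ k.natAbs ^ 2 := Nat.le_self_pow two_ne_zero _
            have h : ((k.natAbs ^ 2 : ℕ) : ℝ) = (k : ℝ) ^ 2 := by
              rw [← Int.cast_natCast, Nat.cast_pow, Int.natAbs_sq, Int.cast_pow]
            rw [← h]
            exact_mod_cast this
          have h2 : (k : ℝ) = (j : ℕ) - ⌊y⌋ := by rw [hk]; push_cast; rfl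
          have h3 := Int.floor_le y
          have h4 := Int.lt_floor_add_one y
          -- `k² ≤ 2 (k - f)² + 2 f²` for the fractional part `f` of `y`
          have h5 : (k : ℝ) ^ 2 ≤ 2 * (y - (j : ℕ)) ^ 2 + 2 := by
            rw [h2]
            nlinarith [sq_nonneg ((j : ℕ) - ⌊y⌋ - 2 * (y - ⌊y⌋) : ℝ)]
          nlinarith
      _ ≤ Real.exp α * ∑' k : ℤ, r ^ k.natAbs := by
          rw [← Finset.mul_sum]
          refine mul_le_mul_of_nonneg_left ?_ (Real.exp_pos _).le
          have := hs.sum_le_tsum (Finset.univ.map ⟨_, hinj⟩) fun k _ => by positivity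
          simpa only [Finset.sum_map, Function.Embedding.coeFn_mk] using this

lemma exists_sum_maternNeedle_le {l ν : ℝ} (hl : 0 < l) (hν : 0 < ν) :
    ∃ K : ℝ, 0 < K ∧ ∀ n : ℕ, n ≠ 0 → ∀ x : Dom d,
      ∑ m : Fin d → Fin n, maternNeedle l ν (((n : ℝ) ^ 2)⁻¹) (gridPoint m) x ≤ K := by
  obtain ⟨K, hK, hsum⟩ := exists_sum_exp_neg_mul_sq_le (α := ν / (4 * l ^ 2)) (by positivity)
  refine ⟨K ^ d, by positivity, fun n hn x => ?_⟩
  have hn' : (0 : ℝ) < n := by exact_mod_cast Nat.pos_of_ne_zero hn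
  have hn1 : (1 : ℝ) ≤ n := by exact_mod_cast Nat.one_le_iff_ne_zero.2 hn
  calc ∑ m : Fin d → Fin n, maternNeedle l ν (((n : ℝ) ^ 2)⁻¹) (gridPoint m) x
      ≤ ∑ m : Fin d → Fin n, ∏ i,
        Real.exp (-(ν / (4 * l ^ 2) * (n * x.1 i - (m i : ℕ)) ^ 2)) := by
        refine Finset.sum_le_sum fun m _ => (maternNeedle_le hl hν (by positivity)
          (inv_le_one_of_one_le₀ (one_le_pow₀ hn1)) _ _).trans_eq ?_
        rw [← Real.exp_sum, Subtype.dist_eq, EuclideanSpace.dist_eq,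
          Real.sq_sqrt (Finset.sum_nonneg fun _ _ => by positivity), Finset.mul_sum,
          Finset.sum_div, ← Finset.sum_neg_distrib]
        congr 1
        refine Finset.sum_congr rfl fun i _ => ?_
        rw [Real.dist_eq, sq_abs]
        simp only [gridPoint]
        field_simp
    _ = ∏ i, ∑ j : Fin n, Real.exp (-(ν / (4 * l ^ 2) * (n * x.1 i - (j : ℕ)) ^ 2)) := by
        rw [Finset.prod_univ_sum, Fintype.piFinset_univ]
    _ ≤ ∏ _i : Fin d, K :=
        Finset.prod_le_prod (fun i _ => Finset.sum_nonneg fun j _ => (Real.exp_pos _).le)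
          fun i _ => hsum n _
    _ = K ^ d := by simp

/-! ### The choice of the grid -/

/-- Needles at the points of a grid with `n ^ d` points, at the height that the budget `C`
allows. -/
lemma regret_of_grid_needles {k : Dom d → Dom d → ℝ} {B B₀ C K N : ℝ} {T n : ℕ} (hT : 0 < T)
    (hn : n ≠ 0) (hK : 0 < K) (hC : 0 ≤ C) (b : (Fin d → Fin n) → Dom d → ℝ)
    (hb0 : ∀ m x, 0 ≤ b m x) (hb1 : ∀ m x, b m x ≤ 1) (hbg : ∀ m, b m (gridPoint m) = 1)
    (hsum : ∀ x, ∑ m, b m x ≤ K) (hmem : ∀ m, b m ∈ rkhsBall k N)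
    (hB : C * n ^ d / (K * T) * N ≤ B) (hB₀ : C * n ^ d / (K * T) ≤ B₀) :
    ∃ adv : Adversary d, adv.Admissible B₀ C T ∧
      ∀ alg : Algorithm d, ∃ f ∈ rkhsBall k B, ∃ xstar : Dom d, (∀ x, f x ≤ f xstar) ∧
        C * (n ^ d / K - 1) ≤ cumRegret alg adv f xstar T := by
  have hT' : (0 : ℝ) < T := by exact_mod_cast hT
  have : Nonempty (Fin n) := ⟨⟨0, Nat.pos_of_ne_zero hn⟩⟩
  have h := regret_of_needles b gridPoint hb0 hb1 hbg hsum hmem (T := T) (C := C)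
    (by positivity) hB hB₀ (le_of_eq ?_) hC
  · have e : C * n ^ d / (K * T) * T - C = C * (n ^ d / K - 1) := by field_simp
    rwa [e] at h
  · simp only [Fintype.card_pi, Fintype.card_fin, Finset.prod_const, Finset.card_univ]
    push_cast
    field_simp

lemma half_le_floor {y : ℝ} (hy : 2 ≤ y) : y / 2 ≤ (⌊y⌋₊ : ℝ) := by
  have := Nat.lt_floor_add_one y
  linarith

/-- The lower bound for the squared exponential kernel, from a grid with `n ≈ √(δ log T)`. -/
lemma exists_adversary_kSE (hd : 1 ≤ d) {l B B₀ c₁ η : ℝ} (hl : 0 < l) (hB : 0 < B) (hB₀ : 0 < B₀)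
    (hc₁ : 0 < c₁) (hη : 0 < η) :
    ∃ c : ℝ, 0 < c ∧ ∃ T₀ : ℕ, ∀ T : ℕ, T₀ ≤ T → ∀ C : ℝ, c₁ ≤ C → C ≤ (T : ℝ) ^ (1 - η) →
      ∃ adv : Adversary d, adv.Admissible B₀ C T ∧
        ∀ alg : Algorithm d, ∃ f ∈ rkhsBall (kSE (d := d) l) B,
          ∃ xstar : Dom d, (∀ x, f x ≤ f xstar) ∧
            c * (C * Real.log T ^ ((d : ℝ) / 2)) ≤ cumRegret alg adv f xstar T := by
  have hd' : (0 : ℝ) < d := by exact_mod_cast hd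
  set c₀ := 2 * Real.pi ^ 2 * l ^ 2 * d with hc₀
  have hc₀0 : 0 < c₀ := by positivity
  -- with `n ^ 2 ≤ δ log T`, the norm `n ^ d * exp (c₀ n ^ 2)` stays below `T ^ (η / 2)`
  set δ := η / (2 * (c₀ + d)) with hδ
  have hδ0 : 0 < δ := by positivity
  have hlog : Tendsto (fun T : ℕ => √(δ * Real.log T)) atTop atTop :=
    Real.tendsto_sqrt_atTop.comp
      ((Real.tendsto_log_atTop.comp tendsto_natCast_atTop_atTop).const_mul_atTop hδ0)
  have hpow : Tendsto (fun T : ℕ => (T : ℝ) ^ (-(η / 2))) atTop (𝓝 0) :=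
    (tendsto_rpow_neg_atTop (by positivity)).comp tendsto_natCast_atTop_atTop
  obtain ⟨T₀, hT₀⟩ := eventually_atTop.1 ((hlog.eventually_ge_atTop 2).and
    ((hpow.eventually_le_const (lt_min hB hB₀)).and (eventually_ge_atTop 1)))
  refine ⟨(√δ / 2) ^ d / 2, by positivity, T₀, fun T hT C hC₁ hC => ?_⟩
  obtain ⟨hy, hTB, hT1⟩ := hT₀ T hT
  have hC0 : 0 < C := hc₁.trans_le hC₁
  have hT' : (0 : ℝ) < T := by exact_mod_cast hT1
  have hL0 : 0 ≤ Real.log T := Real.log_nonneg (by exact_mod_cast hT1)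
  set y := √(δ * Real.log T) with hydef
  set n := ⌊y⌋₊ with hndef
  have hny : (n : ℝ) ≤ y := Nat.floor_le (by positivity)
  have hyn : y / 2 ≤ n := half_le_floor hy
  have hn2 : 2 ≤ n := Nat.le_floor (by exact_mod_cast hy)
  have hn0 : n ≠ 0 := by omega
  have hn2' : (2 : ℝ) ≤ n := by exact_mod_cast hn2
  have hnd : (2 : ℝ) ≤ (n : ℝ) ^ d :=
    hn2'.trans (le_self_pow₀ (by linarith) (by omega))
  have hnsq : (n : ℝ) ^ 2 ≤ δ * Real.log T := by
    rw [← Real.sq_sqrt (mul_nonneg hδ0.le hL0)]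
    exact pow_le_pow_left₀ (by positivity) hny 2
  have hexp : C * n ^ d / (1 * T) * Real.exp (c₀ * (n : ℝ) ^ 2) ≤ (T : ℝ) ^ (-(η / 2)) := by
    have h1 : C / T ≤ (T : ℝ) ^ (-η) := by
      rw [div_le_iff₀ hT', ← Real.rpow_add_one hT'.ne']
      exact hC.trans_eq (by ring_nf)
    have h2 : (n : ℝ) ^ d ≤ Real.exp (d * (n : ℝ) ^ 2) := by
      rw [Real.exp_nat_mul]
      refine pow_le_pow_left₀ (by positivity) ?_ d
      nlinarith [Real.add_one_le_exp ((n : ℝ) ^ 2)]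
    have h3 : Real.exp (d * (n : ℝ) ^ 2) * Real.exp (c₀ * (n : ℝ) ^ 2) ≤ (T : ℝ) ^ (η / 2) := by
      rw [← Real.exp_add, Real.rpow_def_of_pos hT']
      refine Real.exp_le_exp.2 ?_
      calc d * (n : ℝ) ^ 2 + c₀ * (n : ℝ) ^ 2 = (c₀ + d) * (n : ℝ) ^ 2 := by ring
        _ ≤ (c₀ + d) * (δ * Real.log T) := by gcongr
        _ = Real.log T * (η / 2) := by rw [hδ]; field_simp
    calc C * n ^ d / (1 * T) * Real.exp (c₀ * (n : ℝ) ^ 2)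
        = C / T * (n ^ d * Real.exp (c₀ * (n : ℝ) ^ 2)) := by ring
      _ ≤ (T : ℝ) ^ (-η) * (Real.exp (d * (n : ℝ) ^ 2) * Real.exp (c₀ * (n : ℝ) ^ 2)) := by
        gcongr
      _ ≤ (T : ℝ) ^ (-η) * (T : ℝ) ^ (η / 2) := by gcongr
      _ = (T : ℝ) ^ (-(η / 2)) := by rw [← Real.rpow_add hT']; ring_nf
  have hε : C * n ^ d / (1 * T) ≤ B₀ := by
    refine le_trans ?_ (hTB.trans (min_le_right _ _))
    refine le_trans (le_mul_of_one_le_right (by positivity) ?_) hexp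
    exact Real.one_le_exp (by positivity)
  obtain ⟨adv, hadv, hreg⟩ := regret_of_grid_needles hT1 hn0 one_pos hC0.le (seNeedle (d := d) l)
    (seNeedle_nonneg l) (seNeedle_le_one l hn0) (seNeedle_gridPoint l hn0)
    (sum_seNeedle_le_one l hn0) (seNeedle_mem_rkhsBall hl hn0)
    (hexp.trans (hTB.trans (min_le_left _ _))) hε
  refine ⟨adv, hadv, fun alg => ?_⟩
  obtain ⟨f, hf, xstar, hmax, hle⟩ := hreg alg
  refine ⟨f, hf, xstar, hmax, le_trans ?_ hle⟩
  have hLpow : Real.log T ^ ((d : ℝ) / 2) = √(Real.log T) ^ d := by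
    rw [Real.sqrt_eq_rpow, ← Real.rpow_natCast, ← Real.rpow_mul hL0]
    ring_nf
  have hyd : (y / 2) ^ d ≤ (n : ℝ) ^ d := pow_le_pow_left₀ (by positivity) hyn d
  have hyd' : (√δ / 2) ^ d * √(Real.log T) ^ d = (y / 2) ^ d := by
    rw [← mul_pow, hydef, Real.sqrt_mul hδ0.le]
    ring_nf
  calc (√δ / 2) ^ d / 2 * (C * Real.log T ^ ((d : ℝ) / 2))
      = C * ((y / 2) ^ d / 2) := by rw [hLpow, ← hyd']; ring
    _ ≤ C * (n ^ d / 1 - 1) := by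
      refine mul_le_mul_of_nonneg_left ?_ hC0.le
      linarith

/-- The lower bound for the Matérn kernel, from a grid with `n ≈ (δ T / C) ^ (1 / (d + ν))`. -/
lemma exists_adversary_kMatern (hd : 1 ≤ d) {l ν B B₀ c₁ η : ℝ} (hl : 0 < l) (hν : 0 < ν) (hB : 0 < B)
    (hB₀ : 0 < B₀) (hc₁ : 0 < c₁) (hη : 0 < η) :
    ∃ c : ℝ, 0 < c ∧ ∃ T₀ : ℕ, ∀ T : ℕ, T₀ ≤ T → ∀ C : ℝ, c₁ ≤ C → C ≤ (T : ℝ) ^ (1 - η) →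
      ∃ adv : Adversary d, adv.Admissible B₀ C T ∧
        ∀ alg : Algorithm d, ∃ f ∈ rkhsBall (kMatern (d := d) l ν) B,
          ∃ xstar : Dom d, (∀ x, f x ≤ f xstar) ∧
            c * (C ^ (ν / ((d : ℝ) + ν)) * (T : ℝ) ^ ((d : ℝ) / ((d : ℝ) + ν)))
              ≤ cumRegret alg adv f xstar T := by
  have hd' : (0 : ℝ) < d := by exact_mod_cast hd
  obtain ⟨K, hK, hsum⟩ := exists_sum_maternNeedle_le (d := d) hl hν
  have hG := Real.Gamma_pos_of_pos hν
  -- the needles of a grid with `n ^ d` points have norm at most `A * n ^ ν`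
  set A := √(2 * Real.Gamma ν * Real.exp 2) with hA
  have hA0 : 0 < A := by positivity
  set δ := B * K / A with hδ
  have hδ0 : 0 < δ := by positivity
  set Y := max 1 (max (2 * K) ((B / (A * B₀)) ^ ν⁻¹)) with hY
  have hlim : Tendsto (fun T : ℕ => (δ * (T : ℝ) ^ η) ^ ((d : ℝ) + ν)⁻¹) atTop atTop :=
    (tendsto_rpow_atTop (by positivity)).comp
      (((tendsto_rpow_atTop hη).comp tendsto_natCast_atTop_atTop).const_mul_atTop hδ0)
  obtain ⟨T₀, hT₀⟩ := eventually_atTop.1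
    ((hlim.eventually_ge_atTop (2 * Y)).and (eventually_ge_atTop 1))
  refine ⟨δ ^ ((d : ℝ) / (d + ν)) / 2 ^ d / (2 * K), by positivity, T₀, fun T hT C hC₁ hC => ?_⟩
  obtain ⟨hTY, hT1⟩ := hT₀ T hT
  have hC0 : 0 < C := hc₁.trans_le hC₁
  have hT' : (0 : ℝ) < T := by exact_mod_cast hT1
  set y := (δ * (T / C)) ^ ((d : ℝ) + ν)⁻¹ with hy
  have hTC : (T : ℝ) ^ η ≤ T / C := by
    rw [le_div_iff₀ hC0]
    calc (T : ℝ) ^ η * C ≤ (T : ℝ) ^ η * (T : ℝ) ^ (1 - η) := by gcongr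
      _ = T := by rw [← Real.rpow_add hT']; simp
  have hyY : 2 * Y ≤ y := hTY.trans
    (Real.rpow_le_rpow (by positivity) (by gcongr) (by positivity))
  have hY1 : 1 ≤ Y := le_max_left _ _
  set n := ⌊y⌋₊ with hndef
  have hny : (n : ℝ) ≤ y := Nat.floor_le (by positivity)
  have hyn : y / 2 ≤ n := half_le_floor (by linarith)
  have hYn : Y ≤ n := by linarith
  have hn1 : (1 : ℝ) ≤ n := hY1.trans hYn
  have hn0 : n ≠ 0 := by rintro h; rw [h] at hn1; norm_num at hn1
  have hn' : (0 : ℝ) < n := by linarith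
  have hnd : 2 * K ≤ (n : ℝ) ^ d :=
    ((le_max_left _ _).trans (le_max_right _ _)).trans
      (hYn.trans (le_self_pow₀ hn1 (by omega)))
  have hnν : B / (A * B₀) ≤ (n : ℝ) ^ ν := by
    have h : (B / (A * B₀)) ^ ν⁻¹ ≤ n :=
      ((le_max_right _ _).trans (le_max_right _ _)).trans hYn
    have h2 := Real.rpow_le_rpow (by positivity) h hν.le
    rwa [Real.rpow_inv_rpow (by positivity) hν.ne'] at h2
  have hnpow : (n : ℝ) ^ d * (n : ℝ) ^ ν ≤ δ * (T / C) := by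
    rw [← Real.rpow_natCast, ← Real.rpow_add hn']
    have h2 := Real.rpow_le_rpow (by positivity) hny (show 0 ≤ (d : ℝ) + ν by positivity)
    rwa [hy, Real.rpow_inv_rpow (by positivity) (by positivity)] at h2
  have hεN : C * n ^ d / (K * T) * (A * (n : ℝ) ^ ν) ≤ B := by
    calc C * n ^ d / (K * T) * (A * (n : ℝ) ^ ν)
        = C * A / (K * T) * ((n : ℝ) ^ d * (n : ℝ) ^ ν) := by ring
      _ ≤ C * A / (K * T) * (δ * (T / C)) := by gcongr
      _ = B := by rw [hδ]; field_simp
  have hε : C * n ^ d / (K * T) ≤ B₀ := by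
    have h1 : B ≤ B₀ * (A * (n : ℝ) ^ ν) := by
      rw [div_le_iff₀ (by positivity)] at hnν
      linarith
    exact le_of_mul_le_mul_right (hεN.trans h1) (by positivity)
  have hs₀ : (0 : ℝ) < ((n : ℝ) ^ 2)⁻¹ := by positivity
  have hs₁ : ((n : ℝ) ^ 2)⁻¹ ≤ 1 := inv_le_one_of_one_le₀ (one_le_pow₀ hn1)
  obtain ⟨adv, hadv, hreg⟩ := regret_of_grid_needles (k := kMatern l ν) hT1 hn0 hK hC0.le
    (fun m => maternNeedle l ν (((n : ℝ) ^ 2)⁻¹) (gridPoint m))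
    (fun m x => maternNeedle_nonneg _ _ _ _ _)
    (fun m x => (maternNeedle_le hl hν hs₀ hs₁ _ _).trans
      (Real.exp_le_one_iff.2 (neg_nonpos.2 (by positivity))))
    (fun m => maternNeedle_self hν hs₀ hs₁ _) (hsum n hn0)
    (fun m => maternNeedle_mem_rkhsBall hl hν hs₀ hs₁ _ (by positivity) (by
      rw [inv_inv, mul_pow, hA, Real.sq_sqrt (by positivity), ← Real.rpow_natCast,
        ← Real.rpow_natCast, ← Real.rpow_mul hn'.le, ← Real.rpow_mul hn'.le, mul_comm ν])) hεN hε
  refine ⟨adv, hadv, fun alg => ?_⟩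
  obtain ⟨f, hf, xstar, hmax, hle⟩ := hreg alg
  refine ⟨f, hf, xstar, hmax, le_trans ?_ hle⟩
  have hyd : (y / 2) ^ d ≤ (n : ℝ) ^ d := pow_le_pow_left₀ (by positivity) hyn d
  have hypow : y ^ d = δ ^ ((d : ℝ) / (d + ν)) *
      ((T : ℝ) ^ ((d : ℝ) / (d + ν)) / C ^ ((d : ℝ) / (d + ν))) := by
    rw [hy, ← Real.rpow_natCast, ← Real.rpow_mul (by positivity), inv_mul_eq_div,
      Real.mul_rpow hδ0.le (by positivity), Real.div_rpow hT'.le hC0.le]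
  have hCpow : C ^ (ν / ((d : ℝ) + ν)) = C / C ^ ((d : ℝ) / (d + ν)) := by
    nth_rewrite 2 [← Real.rpow_one C]
    rw [← Real.rpow_sub hC0]
    congr 1
    field_simp
    ring
  calc δ ^ ((d : ℝ) / (d + ν)) / 2 ^ d / (2 * K) *
        (C ^ (ν / ((d : ℝ) + ν)) * (T : ℝ) ^ ((d : ℝ) / ((d : ℝ) + ν)))
      = C * ((y / 2) ^ d / (2 * K)) := by rw [div_pow, hypow, hCpow]; ring
    _ ≤ C * (n ^ d / K - 1) := by
      refine mul_le_mul_of_nonneg_left ?_ hC0.le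
      have h1 : 1 ≤ (n : ℝ) ^ d / (2 * K) := (one_le_div (by positivity)).2 hnd
      have h2 : (y / 2) ^ d / (2 * K) ≤ (n : ℝ) ^ d / (2 * K) := by gcongr
      have h3 : (n : ℝ) ^ d / K = (n : ℝ) ^ d / (2 * K) + (n : ℝ) ^ d / (2 * K) := by
        field_simp; ring
      linarith

end CorruptedBandit

end

theorem theorem3
    (d : ℕ) (hd : 1 ≤ d) (l : ℝ) (hl : 0 < l) (B : ℝ) (hB : 0 < B) (B₀ : ℝ) (hB₀ : 0 < B₀)
    (c₁ : ℝ) (hc₁ : 0 < c₁) (η : ℝ) (hη : 0 < η) :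
    -- squared exponential kernel
    (∃ c : ℝ, 0 < c ∧ ∃ T₀ : ℕ, ∀ T : ℕ, T₀ ≤ T → ∀ C : ℝ, c₁ ≤ C → C ≤ (T : ℝ) ^ (1 - η) →
      ∃ adv : Adversary d, adv.Admissible B₀ C T ∧
        ∀ alg : Algorithm d, ∃ f ∈ rkhsBall (kSE (d := d) l) B,
          ∃ xstar : Dom d, (∀ x, f x ≤ f xstar) ∧
            c * (C * Real.log T ^ ((d : ℝ) / 2)) ≤ cumRegret alg adv f xstar T) ∧
    -- Matérn kernel
    (∀ ν : ℝ, 0 < ν →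
      ∃ c : ℝ, 0 < c ∧ ∃ T₀ : ℕ, ∀ T : ℕ, T₀ ≤ T → ∀ C : ℝ, c₁ ≤ C → C ≤ (T : ℝ) ^ (1 - η) →
      ∃ adv : Adversary d, adv.Admissible B₀ C T ∧
        ∀ alg : Algorithm d, ∃ f ∈ rkhsBall (kMatern (d := d) l ν) B,
          ∃ xstar : Dom d, (∀ x, f x ≤ f xstar) ∧
            c * (C ^ (ν / ((d : ℝ) + ν)) * (T : ℝ) ^ ((d : ℝ) / ((d : ℝ) + ν)))
              ≤ cumRegret alg adv f xstar T) :=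
  ⟨exists_adversary_kSE hd hl hB hB₀ hc₁ hη,
    fun _ hν => exists_adversary_kMatern hd hl hν hB hB₀ hc₁ hη⟩
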